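/- Let $n_A,n_B\ge 0$, $n=1+n_A+n_B$, and let $K_n$ be the complete graph on the nodes $X,A_1,\dots,A_{n_A},B_1,\dots,B_{n_B}$. For a finite graph $G=(V,E)$, the cut polytope $\mathrm{CUT}^\square(G)\subseteq\mathbb R^E$ is the convex hull of the cut vectors $\delta(S)$, $S\subseteq V$, where $\delta_{uv}(S)=1$ if exactly one of $u,v$ lies in $S$ and $\delta_{uv}(S)=0$ otherwise. A facet inequality is a valid inequality $\sum_{e\in E}a_ex_e\le a_0$ whose face has dimension one less than that of the polytope. Put $m_A=n_A+\binom{n_B}{2}$ and $m_B=n_B+\binom{n_A}{2}$. Let $K_{1,m_A,m_B}$ be the complete tripartite graph whose classes are $\{X\}$; the nodes $A_i$ together with one new node $A'_{B_jB_{j'}}$ for each $j<j'$; and the nodes $B_j$ together with one new node $B'_{A_iA_{i'}}$ for each $i<i'$. The *triangular elimination* of an inequality $\sum_{uv}a_{uv}x_{uv}\le a_0$ for $\mathrm{CUT}^\square(K_n)$ is the inequality $$\sum_i a_{XA_i}x_{XA_i}+\sum_j a_{XB_j}x_{XB_j}+\sum_{i,j}a_{A_iB_j}x_{A_iB_j}+\sum_{i<i'}\bigl(a_{A_iA_{i'}}x_{A_iB'_{A_iA_{i'}}}-|a_{A_iA_{i'}}|\,x_{A_{i'}B'_{A_iA_{i'}}}\bigr)+\sum_{j<j'}\bigl(a_{B_jB_{j'}}x_{A'_{B_jB_{j'}}B_j}-|a_{B_jB_{j'}}|\,x_{A'_{B_jB_{j'}}B_{j'}}\bigr)\le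 a_0$$ in the edge variables of $K_{1,m_A,m_B}$. *Switching* an inequality at a node set $S$ reverses the signs of the coefficients of the edges with exactly one end in $S$ and subtracts the sum of the old coefficients of these edges from $a_0$. Inequalities that are positive multiples of each other are identified. - Inequalities $f,f'$ for $\mathrm{CUT}^\square(K_n)$ are *equivalent*, $f\sim f'$, if $f$ can be transformed to $f'$ by a permutation of the nodes and a switching, where the permutation fixes $X$ and either maps each of $\{A_i\}$ and $\{B_j\}$ to itself or (possible only when $n_A=n_B$) exchanges these two sets. - Inequalities $F,F'$ for $\mathrm{CUT}^\square(K_{1,m_A,m_B})$ are *equivalent*, $F\sim F'$, if $F$ can be transformed to $F'$ by a permutation of the nodes that is an automorphism of $K_{1,m_A,m_B}$ fixing $X$, and a switching. A *triangle inequality* on three distinct nodes $u,v,w$ is $x_{uv}+x_{uw}+x_{vw}\le 2$ or one of the three inequalities of the form $x_{uv}-x_{uw}-x_{vw}\le 0$. **Theorem.** Let $F$ and $F'$ be the triangular eliminations of facet inequalities $f$ and $f'$ of $\mathrm{CUT}^\square(K_n)$. If $n_A\ne n_B$, assume that $f$ and $f'$ are not, in either order, triangle inequalities such that one has two nodes $A_i,A_{i'}$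 and one node $B_j$ and the other has one node $A_i$ and two nodes $B_j,B_{j'}$, or such that one has three nodes $A_i,A_{i'},A_{i''}$ and the other has three nodes $B_j,B_{j'},B_{j''}$. Then $$f\sim f'\iff F\sim F'.$$ -/

import Mathlib

namespace CutBell

/-! ### Cut polytopes of graphs, linear inequalities, facets -/

section General

variable {V : Type*}

/-- A node set `S` encodes the cut assigning `1` to the nodes of `S` and `0` to the others;
the edge `e` crosses it when its two endpoints receive different values. -/
def Crosses (S : Set V) (e : Sym2 V) : Prop :=
  (∃ u ∈ e, u ∈ S) ∧ (∃ v ∈ e, v ∉ S)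

open scoped Classical in
/-- The cut vector `δ(S)` of a graph, one coordinate for each edge. -/
noncomputable def cutVec (G : SimpleGraph V) (S : Set V) : G.edgeSet → ℝ :=
  fun e => if Crosses S (e : Sym2 V) then 1 else 0

/-- The cut polytope of a graph: the convex hull of all its cut vectors. -/
def cutPolytope (G : SimpleGraph V) : Set (G.edgeSet → ℝ) :=
  convexHull ℝ (Set.range (cutVec G))

/-- A linear inequality `∑ₑ aₑ xₑ ≤ a₀` in the edge variables of `G`. -/
@[ext]
structure Ineq (G : SimpleGraph V) where
  /-- The coefficients `aₑ`. -/
  coeff : G.edgeSet → ℝ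
  /-- The right-hand side `a₀`. -/
  bound : ℝ

namespace Ineq

variable {G : SimpleGraph V}

/-- The left-hand side `∑ₑ aₑ xₑ` (used only for finite node sets). -/
noncomputable def lhs (I : Ineq G) (x : G.edgeSet → ℝ) : ℝ :=
  ∑ᶠ e : G.edgeSet, I.coeff e * x e

/-- The inequality holds on the whole cut polytope. -/
def Valid (I : Ineq G) : Prop :=
  ∀ x ∈ cutPolytope G, I.lhs x ≤ I.bound

/-- The points of the cut polytope where equality holds. -/
def face (I : Ineq G) : Set (G.edgeSet → ℝ) :=
  {x | x ∈ cutPolytope G ∧ I.lhs x = I.bound}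

/-- A facet inequality: it is valid and its face is nonempty, of dimension one less than the
dimension of the cut polytope. -/
def IsFacet (I : Ineq G) : Prop :=
  I.Valid ∧ I.face.Nonempty ∧
    Module.finrank ℝ (vectorSpan ℝ I.face) + 1 =
      Module.finrank ℝ (vectorSpan ℝ (cutPolytope G))

/-- The coefficient of the edge `uv` (zero when `uv` is not an edge). -/
noncomputable def coeffAt (I : Ineq G) (u v : V) : ℝ :=
  open scoped Classical in
  if h : s(u, v) ∈ G.edgeSet then I.coeff ⟨s(u, v), h⟩ else 0

/-- Multiplication of both sides by a constant. -/
def scale (c : ℝ) (I : Ineq G) : Ineq G where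
  coeff e := c * I.coeff e
  bound := c * I.bound

/-- Switching at all the nodes of `S`: exactly the coefficients of the edges crossing `S` change
sign, and the sum of the old coefficients of these edges is subtracted from the right-hand side.
For `S = {v}` this is the switching at the node `v`; in general it is the result of switching at
the nodes of `S` one after the other. -/
noncomputable def switch (S : Set V) (I : Ineq G) : Ineq G where
  coeff e := open scoped Classical in
    if Crosses S (e : Sym2 V) then -I.coeff e else I.coeff e
  bound := I.bound - I.lhs (cutVec G S)

/-- Relabelling along a permutation `σ` of the nodes that preserves the edges of `G`: the new
coefficient of `σ(u)σ(v)` is the old coefficient of `uv`. -/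
def relabel (σ : G ≃g G) (I : Ineq G) : Ineq G where
  coeff e := I.coeff (σ.symm.mapEdgeSet e)
  bound := I.bound

end Ineq

end General

/-! ### The node `X` and the two parties -/

/-- The node `X` together with Alice's nodes (indexed by `α`) and Bob's nodes (indexed by `β`). -/
inductive Node (α β : Type) : Type
  | X : Node α β
  | A : α → Node α β
  | B : β → Node α β
  deriving DecidableEq, Fintype

namespace Node

variable {α β : Type}

/-- The three classes `{X}`, Alice's nodes, Bob's nodes. -/
def part : Node α β → Fin 3
  | X => 0
  | A _ => 1
  | B _ => 2

/-- The set of Alice's nodes. -/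
def alice : Set (Node α β) := Set.range Node.A

/-- The set of Bob's nodes. -/
def bob : Set (Node α β) := Set.range Node.B

end Node

/-- The complete graph on `X`, `A₁, …, A_{nA}`, `B₁, …, B_{nB}`. -/
abbrev completeK (nA nB : ℕ) : SimpleGraph (Node (Fin nA) (Fin nB)) := ⊤

/-- The complete tripartite graph with classes `{X}`, `α`, `β`: two nodes are adjacent exactly
when they lie in different classes. -/
def tripartite (α β : Type) : SimpleGraph (Node α β) :=
  SimpleGraph.comap Node.part ⊤

/-- Pairs `i < i'` of indices. -/
abbrev Pair (n : ℕ) : Type := {p : Fin n × Fin n // p.1 < p.2}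

/-- The complete tripartite graph `K_{1,mA,mB}` on which triangular elimination lives. Alice's
nodes are the old `A_i` (`Sum.inl i`) and a new `A'_{B_j B_j'}` for each pair `j < j'`
(`Sum.inr`), so `mA = nA + nB(nB-1)/2`; similarly for Bob, with `mB = nB + nA(nA-1)/2`. -/
abbrev elimK (nA nB : ℕ) : SimpleGraph (Node (Fin nA ⊕ Pair nB) (Fin nB ⊕ Pair nA)) :=
  tripartite (Fin nA ⊕ Pair nB) (Fin nB ⊕ Pair nA)

/-! ### Triangular elimination -/

open Node in
/-- The coefficients of the triangular elimination, with every edge of the tripartite graph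
listed in one orientation only: `XA`, `XB` or `AB`. -/
noncomputable def elimOriented {nA nB : ℕ} (f : Ineq (completeK nA nB)) :
    Node (Fin nA ⊕ Pair nB) (Fin nB ⊕ Pair nA) →
      Node (Fin nA ⊕ Pair nB) (Fin nB ⊕ Pair nA) → ℝ
  | X, A (.inl i) => f.coeffAt X (A i)
  | X, B (.inl j) => f.coeffAt X (B j)
  | A (.inl i), B (.inl j) => f.coeffAt (A i) (B j)
  | A (.inl i), B (.inr p) =>
      if i = p.1.1 then f.coeffAt (A p.1.1) (A p.1.2)
      else if i = p.1.2 then -|f.coeffAt (A p.1.1) (A p.1.2)|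
      else 0
  | A (.inr p), B (.inl j) =>
      if j = p.1.1 then f.coeffAt (B p.1.1) (B p.1.2)
      else if j = p.1.2 then -|f.coeffAt (B p.1.1) (B p.1.2)|
      else 0
  | _, _ => 0

/-- The triangular elimination of an inequality for the complete graph. Only one of the two
orientations of an edge contributes to its coefficient. -/
noncomputable def triElim {nA nB : ℕ} (f : Ineq (completeK nA nB)) : Ineq (elimK nA nB) where
  coeff e := Sym2.lift ⟨fun u v => elimOriented f u v + elimOriented f v u,
    fun _ _ => add_comm _ _⟩ (e : Sym2 _)
  bound := f.bound

/-! ### Equivalence before and after triangular elimination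

A facet determines its inequality up to a positive factor only, so both relations identify
positive multiples. -/

/-- Permutations of the nodes of the complete graph that fix `X` and either preserve each party
or exchange the two parties (the latter is possible only if `nA = nB`). -/
def RespectsParties {nA nB : ℕ} (τ : completeK nA nB ≃g completeK nA nB) : Prop :=
  τ Node.X = Node.X ∧
    ((τ '' Node.alice = Node.alice ∧ τ '' Node.bob = Node.bob) ∨
      (τ '' Node.alice = Node.bob ∧ τ '' Node.bob = Node.alice))

/-- `f ∼ f'` for the complete graph: `f` is transformed to `f'` by a permutation respecting `X`
and the parties, and a switching. -/
def EquivComplete {nA nB : ℕ} (f f' : Ineq (completeK nA nB)) : Prop :=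
  ∃ (τ : completeK nA nB ≃g completeK nA nB) (S : Set (Node (Fin nA) (Fin nB))) (c : ℝ),
    RespectsParties τ ∧ 0 < c ∧ f' = ((f.relabel τ).switch S).scale c

/-- `F ∼ F'` for a complete tripartite graph: `F` is transformed to `F'` by a permutation of the
nodes (an automorphism of the graph) that fixes `X`, and a switching. -/
def EquivTripartite {α β : Type} (F F' : Ineq (tripartite α β)) : Prop :=
  ∃ (σ : tripartite α β ≃g tripartite α β) (S : Set (Node α β)) (c : ℝ),
    σ Node.X = Node.X ∧ 0 < c ∧ F' = ((F.relabel σ).switch S).scale c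

/-! ### Triangle inequalities -/

/-- The triangle inequality `x_{uv} - x_{uw} - x_{vw} ≤ 0`. -/
noncomputable def triangleIneq {V : Type*} (G : SimpleGraph V) (u v w : V) : Ineq G where
  coeff e := open scoped Classical in
    if (e : Sym2 V) = s(u, v) then 1
    else if (e : Sym2 V) = s(u, w) ∨ (e : Sym2 V) = s(v, w) then -1
    else 0
  bound := 0

/-- `f` is, up to a positive factor, one of the four triangle inequalities on the distinct nodes
`u, v, w`. The four (three of the form `x_{uv} - x_{uw} - x_{vw} ≤ 0`, and
`x_{uv} + x_{uw} + x_{vw} ≤ 2`) are the switchings of any one of them. -/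
def IsTriangleOn {V : Type*} {G : SimpleGraph V} (f : Ineq G) (u v w : V) : Prop :=
  u ≠ v ∧ u ≠ w ∧ v ≠ w ∧
    ∃ (S : Set V) (c : ℝ), 0 < c ∧ f = ((triangleIneq G u v w).switch S).scale c

open Node in
/-- `f` and `f'` are triangle inequalities on nodes other than `X`, and the parties of the nodes
of `f'` are those of the nodes of `f` with Alice and Bob exchanged: `f` has nodes `A, A, B` and
`f'` has nodes `B, B, A`, or `f` has nodes `A, A, A` and `f'` has nodes `B, B, B`. -/
def OppositeTriangles {nA nB : ℕ} (f f' : Ineq (completeK nA nB)) : Prop :=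
  (∃ i₁ i₂ j k₁ k₂ l, IsTriangleOn f (A i₁) (A i₂) (B j) ∧
    IsTriangleOn f' (B k₁) (B k₂) (A l)) ∨
  (∃ i₁ i₂ i₃ j₁ j₂ j₃, IsTriangleOn f (A i₁) (A i₂) (A i₃) ∧
    IsTriangleOn f' (B j₁) (B j₂) (B j₃))

end CutBell

namespace CutBell

/-! A facet inequality is tight: its bound is the maximum of its left-hand side over cuts.
Triangular elimination keeps this (`Ineq.Tight.triElim`), and so do relabelling, switching and
positive scaling. The bound is thus determined by the coefficients, and either equivalence says only
that the coefficients correspond under a node bijection, signs at the nodes and a positive factor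
(`Ineq.Matches`).

From $f\sim f'$ to $F\sim F'$: a permutation of $K_n$ lifts to old and new nodes. At the new node of
a pair with coefficient $a$ the two nonzero coefficients are $a$ and $-|a|$ in an order that depends
on the indices. Their absolute values and their product $-a|a|$ do not depend on it, and this
suffices to choose a sign at the new node (`exists_sign`).

From $F\sim F'$ to $f\sim f'$, the danger is that the automorphism mixes old and new nodes. Degrees
in the support control this: a new node has degree at most two in the support of $F$, while an old
node has the same degree for $F$ as for $f$ (`big_old_iff`). A facet of the cut polytope of a
complete graph whose support has a node of degree one or two is a triangle inequality, since a
triangle inequality can be split off and facets are extremal (`Ineq.IsFacet.triangleCoeffs`). So,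
for $n\ge 3$, either $f$ is a triangle inequality or every node of its support has degree at least
three. As degrees are preserved, $f$ and $f'$ fall under the same alternative.

If all degrees are at least three, old support nodes go to old support nodes, the new node of a pair
is the only low-degree common neighbour of the pair, and $a$ is recovered from $-a|a|$ because
$x\mapsto x|x|$ is injective (`equivComplete_of_big`). For triangle inequalities the number of
support nodes of $F$ is 3, 4 or 6 and shows how the triangle is spread over the classes. If $X$ is
not in it, $AAB$ and $ABB$ both give 4-cycles, and $AAA$ and $BBB$ both give hexagons. These are the
excluded cases, harmless when $n_A=n_B$ (`equivComplete_of_triangle_matches`). -/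

open scoped Classical in
/-- The indicator that `u` and `v` lie on different sides of `S`. -/
noncomputable def sep {V : Type*} (S : Set V) (u v : V) : ℝ :=
  if (u ∈ S ↔ v ∈ S) then 0 else 1

open scoped Classical in
/-- The sign `-1` on `S` and `1` elsewhere. -/
noncomputable def sideSign {V : Type*} (S : Set V) (u : V) : ℝ :=
  if u ∈ S then -1 else 1

/-- A function with values `1` and `-1`. -/
def IsSign {V : Type*} (s : V → ℝ) : Prop := ∀ v, s v = 1 ∨ s v = -1

/-! ### Coefficients, switching, relabelling and tight inequalities -/

section General

variable {V : Type*} {G : SimpleGraph V}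

theorem crosses_mk (S : Set V) (u v : V) : Crosses S s(u, v) ↔ ¬ (u ∈ S ↔ v ∈ S) := by
  simp only [Crosses, Sym2.mem_iff]
  constructor
  · rintro ⟨⟨x, rfl | rfl, hx⟩, ⟨y, rfl | rfl, hy⟩⟩ <;> tauto
  · intro h
    by_cases hu : u ∈ S
    · exact ⟨⟨u, Or.inl rfl, hu⟩, ⟨v, Or.inr rfl, by tauto⟩⟩
    · exact ⟨⟨v, Or.inr rfl, by tauto⟩, ⟨u, Or.inl rfl, hu⟩⟩

theorem crosses_symmDiff (S T : Set V) (u v : V) :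
    Crosses (symmDiff S T) s(u, v) ↔ ¬ (Crosses S s(u, v) ↔ Crosses T s(u, v)) := by
  rw [crosses_mk, crosses_mk, crosses_mk, Set.mem_symmDiff, Set.mem_symmDiff]
  by_cases u ∈ S <;> by_cases v ∈ S <;> by_cases u ∈ T <;> by_cases v ∈ T <;> simp_all

theorem cutVec_mk (S : Set V) (u v : V) (h : s(u, v) ∈ G.edgeSet) :
    cutVec G S ⟨s(u, v), h⟩ = sep S u v := by
  simp only [cutVec, sep]
  have := crosses_mk S u v
  split_ifs <;> first | rfl | (exfalso; tauto)

theorem sep_comm (S : Set V) (u v : V) : sep S u v = sep S v u := by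
  unfold sep
  split_ifs <;> first | rfl | (exfalso; tauto)

@[simp] theorem sep_self (S : Set V) (u : V) : sep S u u = 0 := by simp [sep]

theorem isSign_sideSign (S : Set V) : IsSign (sideSign S) := by
  intro v; unfold sideSign; split_ifs <;> simp

namespace Ineq

theorem coeffAt_mk (I : Ineq G) {u v : V} (h : s(u, v) ∈ G.edgeSet) :
    I.coeffAt u v = I.coeff ⟨s(u, v), h⟩ := by
  simp only [coeffAt, dif_pos h]

theorem coeffAt_of_not_adj (I : Ineq G) {u v : V} (h : ¬ G.Adj u v) : I.coeffAt u v = 0 := by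
  exact dif_neg (mt (G.mem_edgeSet).1 h)

@[simp] theorem coeffAt_self (I : Ineq G) (u : V) : I.coeffAt u u = 0 :=
  I.coeffAt_of_not_adj (G.irrefl)

theorem coeffAt_comm (I : Ineq G) (u v : V) : I.coeffAt u v = I.coeffAt v u := by
  by_cases h : G.Adj u v
  · rw [I.coeffAt_mk (G.mem_edgeSet.2 h), I.coeffAt_mk (G.mem_edgeSet.2 h.symm)]
    congr 2
    exact Sym2.eq_swap
  · rw [I.coeffAt_of_not_adj h, I.coeffAt_of_not_adj (fun h' => h h'.symm)]

theorem coeff_ext {I J : Ineq G} (h : ∀ u v, G.Adj u v → I.coeffAt u v = J.coeffAt u v) :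
    I.coeff = J.coeff := by
  funext ⟨e, he⟩
  induction e using Sym2.ind with
  | _ u v =>
    rw [← I.coeffAt_mk he, ← J.coeffAt_mk he]
    exact h u v he

theorem coeffAt_scale (c : ℝ) (I : Ineq G) (u v : V) :
    (I.scale c).coeffAt u v = c * I.coeffAt u v := by
  simp only [coeffAt, scale]
  split_ifs <;> simp

theorem coeffAt_switch (S : Set V) (I : Ineq G) (u v : V) :
    (I.switch S).coeffAt u v = sideSign S u * sideSign S v * I.coeffAt u v := by
  simp only [coeffAt, switch, sideSign]
  have := crosses_mk S u v
  split_ifs <;> first | (exfalso; tauto) | ring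

theorem coeffAt_relabel (σ : G ≃g G) (I : Ineq G) (u v : V) :
    (I.relabel σ).coeffAt (σ u) (σ v) = I.coeffAt u v := by
  by_cases h : G.Adj u v
  · have h' : G.Adj (σ u) (σ v) := σ.map_adj_iff.2 h
    rw [coeffAt_mk _ (G.mem_edgeSet.2 h), coeffAt_mk _ (G.mem_edgeSet.2 h')]
    simp only [relabel]
    congr 1
    exact (Equiv.symm_apply_eq σ.mapEdgeSet).2 rfl
  · rw [coeffAt_of_not_adj _ h, coeffAt_of_not_adj]
    rwa [σ.map_adj_iff]

/-- The bound is the maximum of the left-hand side over all cuts. -/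
def Tight (I : Ineq G) : Prop :=
  IsGreatest (Set.range fun T : Set V => I.lhs (cutVec G T)) I.bound

/-- A maximum over cuts is determined by the coefficients; from here on only coefficients need to be
compared. -/
theorem Tight.eq_of_coeff {I J : Ineq G} (hI : I.Tight) (hJ : J.Tight)
    (h : I.coeff = J.coeff) : I = J := by
  have : I.bound = J.bound := by
    refine hI.unique ?_
    have hl : I.lhs = J.lhs := by funext x; simp only [lhs, h]
    rw [hl]
    exact hJ
  exact Ineq.ext h this

theorem lhs_scale (c : ℝ) (I : Ineq G) (x : G.edgeSet → ℝ) :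
    (I.scale c).lhs x = c * I.lhs x := by
  simp only [lhs, scale, mul_assoc]
  by_cases hc : c = 0
  · simp [hc]
  · exact (smul_finsum c _).symm

theorem Tight.scale {I : Ineq G} (hI : I.Tight) {c : ℝ} (hc : 0 < c) : (I.scale c).Tight := by
  obtain ⟨⟨T, hT⟩, hub⟩ := hI
  refine ⟨⟨T, ?_⟩, ?_⟩
  · simp only [lhs_scale] at hT ⊢
    rw [hT]; rfl
  · rintro _ ⟨S, rfl⟩
    simp only [lhs_scale]
    exact mul_le_mul_of_nonneg_left (hub ⟨S, rfl⟩) hc.le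

theorem crosses_map (σ : G ≃g G) (T : Set V) (e : G.edgeSet) :
    Crosses T (σ.mapEdgeSet e : Sym2 V) ↔ Crosses (σ ⁻¹' T) (e : Sym2 V) := by
  obtain ⟨e, he⟩ := e
  induction e using Sym2.ind with
  | _ u v =>
    have : ((σ.mapEdgeSet ⟨s(u, v), he⟩ : G.edgeSet) : Sym2 V) = s(σ u, σ v) := rfl
    rw [this, crosses_mk, crosses_mk]
    rfl

theorem lhs_relabel (σ : G ≃g G) (I : Ineq G) (T : Set V) :
    (I.relabel σ).lhs (cutVec G T) = I.lhs (cutVec G (σ ⁻¹' T)) := by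
  simp only [lhs]
  rw [← finsum_comp_equiv σ.mapEdgeSet]
  refine finsum_congr fun e => ?_
  have h1 : σ.symm.mapEdgeSet (σ.mapEdgeSet e) = e := Equiv.symm_apply_apply σ.mapEdgeSet e
  have h2 := crosses_map σ T e
  simp only [relabel, cutVec, h1]
  split_ifs <;> first | rfl | (exfalso; tauto)

theorem Tight.relabel {I : Ineq G} (hI : I.Tight) (σ : G ≃g G) : (I.relabel σ).Tight := by
  obtain ⟨⟨T, hT⟩, hub⟩ := hI
  refine ⟨⟨σ '' T, ?_⟩, ?_⟩
  · simp only [lhs_relabel]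
    rw [Set.preimage_image_eq _ σ.injective]
    exact hT
  · rintro _ ⟨S, rfl⟩
    simp only [lhs_relabel]
    exact hub ⟨_, rfl⟩

/-- An edge crosses $S\triangle T$ exactly when it crosses one of $S,T$. With $s,t\in\{0,1\}$ its
values at $S$ and $T$, the value at $S\triangle T$ minus $s$ is $(1-2s)t$, the switched term. -/
theorem lhs_switch [Finite V] (S T : Set V) (I : Ineq G) :
    (I.switch S).lhs (cutVec G T) =
      I.lhs (cutVec G (symmDiff S T)) - I.lhs (cutVec G S) := by
  simp only [lhs]
  rw [← finsum_sub_distrib (Set.toFinite _) (Set.toFinite _)]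
  refine finsum_congr fun ⟨e, he⟩ => ?_
  induction e using Sym2.ind with
  | _ u v =>
    simp only [switch, cutVec]
    have h := crosses_symmDiff S T u v
    split_ifs <;> first | (exfalso; tauto) | ring

theorem Tight.switch [Finite V] {I : Ineq G} (hI : I.Tight) (S : Set V) :
    (I.switch S).Tight := by
  obtain ⟨⟨T, hT⟩, hub⟩ := hI
  refine ⟨⟨symmDiff S T, ?_⟩, ?_⟩
  · simp only [lhs_switch, symmDiff_symmDiff_cancel_left]
    simp only at hT
    rw [hT]; rfl
  · rintro _ ⟨T', rfl⟩
    simp only [lhs_switch]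
    exact sub_le_sub_right (hub ⟨_, rfl⟩) _

/-- `J` arises from `I` by the node bijection `σ`, sign changes of the nodes, and a positive
factor, as far as the coefficients are concerned. -/
def Matches (I J : Ineq G) (σ : V → V) : Prop :=
  ∃ (s : V → ℝ) (c : ℝ), IsSign s ∧ 0 < c ∧
    ∀ u v, J.coeffAt (σ u) (σ v) = c * (s u * s v) * I.coeffAt u v

theorem matches_of_eq (I : Ineq G) (σ : G ≃g G) (S : Set V) {c : ℝ} (hc : 0 < c) :
    I.Matches (((I.relabel σ).switch S).scale c) σ :=
  ⟨fun v => sideSign S (σ v), c, fun v => isSign_sideSign S _, hc, fun u v => by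
    rw [coeffAt_scale, coeffAt_switch, coeffAt_relabel]; ring⟩

/-- Converse of `matches_of_eq`: the sign function, transported by `σ`, is that of switching at the
nodes where it equals $-1$, and tightness takes care of the bounds. -/
theorem Matches.exists_eq [Finite V] {I J : Ineq G} (hI : I.Tight) (hJ : J.Tight)
    {σ : G ≃g G} (h : I.Matches J σ) :
    ∃ (S : Set V) (c : ℝ), 0 < c ∧ J = ((I.relabel σ).switch S).scale c := by
  obtain ⟨s, c, hs, hc, h⟩ := h
  refine ⟨{v | s (σ.symm v) = -1}, c, hc, hJ.eq_of_coeff (((hI.relabel σ).switch _).scale hc) ?_⟩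
  refine coeff_ext fun u v _ => ?_
  obtain ⟨u, rfl⟩ := σ.surjective u
  obtain ⟨v, rfl⟩ := σ.surjective v
  rw [h, coeffAt_scale, coeffAt_switch, coeffAt_relabel]
  have key : ∀ v, sideSign {v | s (σ.symm v) = -1} (σ v) = s v := by
    intro v
    rcases hs v with h | h
    · simp [sideSign, h]; norm_num
    · simp [sideSign, h]
  rw [key, key]; ring

-- Every edge carries two darts, so the sum over ordered pairs counts it twice. This form lets node
-- sums be split by class.
open scoped Classical in
theorem two_mul_lhs_cutVec [Fintype V] (I : Ineq G) (T : Set V) :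
    2 * I.lhs (cutVec G T) = ∑ u, ∑ v, I.coeffAt u v * sep T u v := by
  set g : Sym2 V → ℝ := fun e => if h : e ∈ G.edgeSet then I.coeff ⟨e, h⟩ * cutVec G T ⟨e, h⟩ else 0
  have hg : ∀ u v, I.coeffAt u v * sep T u v = g s(u, v) := by
    intro u v
    by_cases h : s(u, v) ∈ G.edgeSet
    · rw [I.coeffAt_mk h, ← cutVec_mk T u v h]
      simp [g, h]
    · rw [coeffAt_of_not_adj _ h]
      simp only [g, dif_neg h, zero_mul]
  have h1 : I.lhs (cutVec G T) = ∑ e ∈ G.edgeFinset, g e := by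
    rw [lhs, finsum_eq_sum_of_fintype, ← Finset.sum_coe_sort G.edgeFinset]
    refine Fintype.sum_equiv (Equiv.subtypeEquivRight (by simp)) _ _ ?_
    rintro ⟨e, he⟩
    simp only [g, Equiv.subtypeEquivRight_apply_coe, dif_pos he]
  have h2 : ∑ d : G.Dart, g d.edge = ∑ u, ∑ v, g s(u, v) := by
    rw [← Fintype.sum_prod_type' (f := fun u v => g s(u, v))]
    have : ∑ x : V × V, g s(x.1, x.2) = ∑ x : V × V with G.Adj x.1 x.2, g s(x.1, x.2) := by
      rw [Finset.sum_filter_of_ne]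
      intro x _ hx
      by_contra hadj
      exact hx (dif_neg hadj)
    rw [this]
    refine Finset.sum_bij (fun d _ => d.toProd) ?_ ?_ ?_ ?_
    · intro d _; simp
    · intro d _ d' _ h; exact SimpleGraph.Dart.ext _ _ h
    · intro x hx; exact ⟨⟨x, by simpa using hx⟩, by simp, rfl⟩
    · intro d _; rfl
  simp only [hg]
  rw [← h2, h1, ← Finset.sum_fiberwise_of_maps_to (s := Finset.univ) (t := G.edgeFinset)
    (g := fun d : G.Dart => d.edge) (fun d _ => by simp [d.edge_mem]), Finset.mul_sum]
  refine Finset.sum_congr rfl fun e he => ?_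
  rw [Finset.sum_congr rfl (g := fun _ => g e) (fun d hd => by
    rw [(Finset.mem_filter.1 hd).2]), Finset.sum_const,
    G.dart_edge_fiber_card e (by simpa using he)]
  simp

end Ineq

end General

/-! ### Facets: tightness and extremality -/

namespace Ineq

section General

variable {V : Type*} {G : SimpleGraph V}

/-- The linear functional `x ↦ ∑ₑ aₑ xₑ`. -/
noncomputable def functional [Finite V] (I : Ineq G) : (G.edgeSet → ℝ) →ₗ[ℝ] ℝ where
  toFun := I.lhs
  map_add' x y := by
    simp only [lhs, Pi.add_apply, mul_add]
    exact finsum_add_distrib (Set.toFinite _) (Set.toFinite _)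
  map_smul' c x := by
    simp only [lhs, Pi.smul_apply, smul_eq_mul, RingHom.id_apply, mul_left_comm _ c]
    exact (smul_finsum c _).symm

theorem functional_apply [Finite V] (I : Ineq G) (x : G.edgeSet → ℝ) :
    I.functional x = I.lhs x := rfl

open scoped Classical in
theorem functional_single [Finite V] (I : Ineq G) (e : G.edgeSet) (t : ℝ) :
    I.functional (Pi.single e t) = I.coeff e * t := by
  rw [functional_apply, lhs, finsum_eq_single _ e, Pi.single_eq_same]
  intro e' he'
  rw [Pi.single_eq_of_ne he', mul_zero]

theorem coeff_eq_of_functional [Finite V] {I J : Ineq G} {l : ℝ}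
    (h : ∀ x, I.functional x = l * J.functional x) (e : G.edgeSet) :
    I.coeff e = l * J.coeff e := by
  classical
  simpa [functional_single] using h (Pi.single e 1)

theorem valid_of_cuts [Finite V] {I : Ineq G} (h : ∀ T, I.lhs (cutVec G T) ≤ I.bound) :
    I.Valid := by
  have hc : Convex ℝ {x | I.functional x ≤ I.bound} :=
    convex_halfSpace_le I.functional.isLinear _
  have : cutPolytope G ⊆ {x | I.functional x ≤ I.bound} :=
    convexHull_min (by rintro _ ⟨T, rfl⟩; exact h T) hc
  exact fun x hx => this hx

/-- If no cut attained the bound, the polytope would lie in the open half-space, which is convex,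
and the face would be empty. -/
theorem IsFacet.tight [Finite V] {I : Ineq G} (h : I.IsFacet) : I.Tight := by
  obtain ⟨hv, ⟨x, hx, hxb⟩, -⟩ := h
  have hub : ∀ T, I.lhs (cutVec G T) ≤ I.bound :=
    fun T => hv _ (subset_convexHull ℝ _ ⟨T, rfl⟩)
  refine ⟨?_, by rintro _ ⟨T, rfl⟩; exact hub T⟩
  by_contra hne
  have hlt : ∀ T, I.lhs (cutVec G T) < I.bound :=
    fun T => lt_of_le_of_ne (hub T) fun h => hne ⟨T, h⟩
  have hc : Convex ℝ {x | I.functional x < I.bound} :=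
    convex_halfSpace_lt I.functional.isLinear _
  have : cutPolytope G ⊆ {x | I.functional x < I.bound} :=
    convexHull_min (by rintro _ ⟨T, rfl⟩; exact hlt T) hc
  exact absurd hxb (this hx).ne

theorem IsFacet.coeff_ne_zero {I : Ineq G} (h : I.IsFacet) : I.coeff ≠ 0 := by
  obtain ⟨-, ⟨x, hx, hxb⟩, hd⟩ := h
  intro h0
  have hl : ∀ y, I.lhs y = 0 := fun y => by simp [lhs, h0]
  have : I.face = cutPolytope G := by
    ext y
    simp only [face, Set.mem_ofPred_eq, hl] at hxb ⊢
    simp [hxb]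
  rw [this] at hd
  omega

end General

section Complete

variable {V : Type*} [Finite V]

/-- Since $\delta(\emptyset)=0$, all cut vectors lie in the span, and the unit vector of the edge
$uv$ is $\frac12(\delta(\{u\})+\delta(\{v\})-\delta(\{u,v\}))$. -/
theorem vectorSpan_cutPolytope_top :
    vectorSpan ℝ (cutPolytope (⊤ : SimpleGraph V)) = ⊤ := by
  classical
  have hmem : ∀ T, cutVec (⊤ : SimpleGraph V) T ∈
      vectorSpan ℝ (cutPolytope (⊤ : SimpleGraph V)) := by
    intro T
    have h := vsub_mem_vectorSpan ℝ
      (subset_convexHull ℝ _ (Set.mem_range_self T) : cutVec (⊤ : SimpleGraph V) T ∈ _)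
      (subset_convexHull ℝ _ (Set.mem_range_self ∅) : cutVec (⊤ : SimpleGraph V) ∅ ∈ _)
    have h0 : cutVec (⊤ : SimpleGraph V) ∅ = 0 := by
      funext e; simp [cutVec, Crosses]
    rw [h0, vsub_eq_sub, sub_zero] at h
    exact h
  rw [eq_top_iff]
  have hs : ∀ e : (⊤ : SimpleGraph V).edgeSet,
      (Pi.single e (1 : ℝ) : (⊤ : SimpleGraph V).edgeSet → ℝ) ∈
        vectorSpan ℝ (cutPolytope (⊤ : SimpleGraph V)) := by
    rintro ⟨e, he⟩
    induction e using Sym2.ind with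
    | _ u v =>
      have huv : u ≠ v := he
      have key : (Pi.single ⟨s(u, v), he⟩ (1 : ℝ) : (⊤ : SimpleGraph V).edgeSet → ℝ) =
          (1 / 2 : ℝ) • (cutVec ⊤ {u} + cutVec ⊤ {v} - cutVec ⊤ {u, v}) := by
        funext ⟨e, he'⟩
        induction e using Sym2.ind with
        | _ x y =>
          have hxy : x ≠ y := he'
          simp only [Pi.single_apply, Pi.smul_apply, Pi.add_apply, Pi.sub_apply, cutVec_mk, sep,
            Set.mem_singleton_iff, Set.mem_insert_iff, Subtype.mk.injEq, Sym2.eq_iff, smul_eq_mul]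
          by_cases h1 : x = u
          · subst h1
            by_cases h2 : y = v
            · subst h2; simp [huv, huv.symm]; norm_num
            · simp [huv, h2, hxy.symm]
          · by_cases h2 : x = v
            · subst h2
              by_cases h3 : y = u
              · subst h3; simp [huv, huv.symm]; norm_num
              · simp [h1, h3, hxy.symm]
            · by_cases h3 : y = u
              · subst h3
                simp [h1, h2, huv]
              · by_cases h4 : y = v
                · subst h4
                  simp [h1, h2, huv.symm]
                · simp [h1, h2, h3, h4]
      rw [key]
      exact Submodule.smul_mem _ _
        (Submodule.sub_mem _ (Submodule.add_mem _ (hmem _) (hmem _)) (hmem _))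
  intro x _
  have := Fintype.ofFinite (⊤ : SimpleGraph V).edgeSet
  rw [pi_eq_sum_univ' x]
  refine Submodule.sum_mem _ fun e _ => Submodule.smul_mem _ _ ?_
  convert hs e using 1

/-- A facet inequality is extremal among the valid inequalities. -/
theorem IsFacet.extremal {f g h : Ineq (⊤ : SimpleGraph V)} (hf : f.IsFacet)
    (hg : ∀ T, g.lhs (cutVec ⊤ T) ≤ g.bound) (hh : ∀ T, h.lhs (cutVec ⊤ T) ≤ h.bound)
    (hc : ∀ e, f.coeff e = g.coeff e + h.coeff e) (hb : f.bound = g.bound + h.bound) :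
    ∃ l : ℝ, 0 ≤ l ∧ (∀ e, g.coeff e = l * f.coeff e) ∧ g.bound = l * f.bound := by
  have hlin : ∀ x, f.lhs x = g.lhs x + h.lhs x := by
    intro x
    simp only [lhs, hc, add_mul]
    exact finsum_add_distrib (Set.toFinite _) (Set.toFinite _)
  -- Two valid inequalities whose sum is an equality are both equalities.
  have hgface : ∀ x ∈ f.face, g.lhs x = g.bound := by
    rintro x ⟨hx, hxb⟩
    have h1 := valid_of_cuts hg x hx
    have h2 := valid_of_cuts hh x hx
    have h3 := hlin x
    linarith
  set D := vectorSpan ℝ f.face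
  have hD : ∀ (I : Ineq (⊤ : SimpleGraph V)) (b : ℝ), (∀ x ∈ f.face, I.lhs x = b) →
      D ≤ LinearMap.ker I.functional := by
    intro I b hI
    refine Submodule.span_le.2 ?_
    rintro _ ⟨x, hx, y, hy, rfl⟩
    change I.functional (x - y) = 0
    rw [map_sub, functional_apply, functional_apply, hI x hx, hI y hy, sub_self]
  have hDf := hD f f.bound fun x hx => hx.2
  have hDg := hD g g.bound hgface
  obtain ⟨y, hy⟩ : ∃ y, f.functional y ≠ 0 := by
    by_contra! h0
    refine hf.coeff_ne_zero (funext fun e => ?_)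
    have := coeff_eq_of_functional (I := f) (J := f) (l := 0) (fun x => by rw [h0]; simp) e
    simpa using this
  -- The polytope is full-dimensional, so the directions of the face fill the kernel of `f`; as `g`
  -- vanishes on them, it is a multiple of `f`.
  have hker : D = LinearMap.ker f.functional := by
    refine Submodule.eq_of_le_of_finrank_le hDf ?_
    have h1 := hf.2.2
    rw [vectorSpan_cutPolytope_top, finrank_top] at h1
    have h2 : Module.finrank ℝ (LinearMap.ker f.functional) <
        Module.finrank ℝ ((⊤ : SimpleGraph V).edgeSet → ℝ) := by
      refine Submodule.finrank_lt fun htop => hy ?_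
      have : y ∈ LinearMap.ker f.functional := htop ▸ Submodule.mem_top
      exact this
    change _ ≤ Module.finrank ℝ (vectorSpan ℝ f.face)
    omega
  set l := g.functional y / f.functional y
  have hl : ∀ x, g.functional x = l * f.functional x := by
    intro x
    have hx : x - (f.functional x / f.functional y) • y ∈ LinearMap.ker f.functional := by
      rw [LinearMap.mem_ker, map_sub, map_smul, smul_eq_mul, div_mul_cancel₀ _ hy, sub_self]
    have hx' : g.functional (x - (f.functional x / f.functional y) • y) = 0 :=
      hDg (hker ▸ hx)
    rw [map_sub, map_smul, smul_eq_mul, sub_eq_zero] at hx'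
    rw [hx']
    simp only [l]
    ring
  have hlb : g.bound = l * f.bound := by
    obtain ⟨x, hx⟩ := hf.2.1
    rw [← hgface x hx, ← hx.2]
    exact hl x
  refine ⟨l, ?_, coeff_eq_of_functional hl, hlb⟩
  -- A cut off the face exists for dimension reasons, and validity of `g` there fixes the sign of
  -- `l`.
  obtain ⟨T, hT⟩ : ∃ T, f.lhs (cutVec ⊤ T) < f.bound := by
    by_contra! hge
    have hall : ∀ x ∈ cutPolytope (⊤ : SimpleGraph V), f.lhs x = f.bound := by
      intro x hx
      refine le_antisymm (hf.1 x hx) ?_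
      have hconv : Convex ℝ {x | f.bound ≤ f.functional x} :=
        convex_halfSpace_ge f.functional.isLinear _
      exact convexHull_min (by rintro _ ⟨T, rfl⟩; exact hge T) hconv hx
    have hface : f.face = cutPolytope ⊤ := by
      ext x; exact ⟨fun hx => hx.1, fun hx => ⟨hx, hall x hx⟩⟩
    have := hf.2.2
    rw [hface] at this
    omega
  have h1 : g.lhs (cutVec ⊤ T) = l * f.lhs (cutVec ⊤ T) := hl _
  have h2 := hg T
  rw [h1, hlb] at h2
  by_contra! hneg
  nlinarith

/-- An inequality supported on the triangle `u, v, w`. -/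
noncomputable def onTriangle (u v w : V) (p q r b : ℝ) : Ineq (⊤ : SimpleGraph V) where
  coeff e := open scoped Classical in
    (if (e : Sym2 V) = s(u, v) then p else 0) + (if (e : Sym2 V) = s(u, w) then q else 0) +
      (if (e : Sym2 V) = s(v, w) then r else 0)
  bound := b

theorem lhs_onTriangle {u v w : V} (huv : u ≠ v) (huw : u ≠ w) (hvw : v ≠ w) (p q r b : ℝ)
    (T : Set V) : (onTriangle u v w p q r b).lhs (cutVec ⊤ T) =
      p * sep T u v + q * sep T u w + r * sep T v w := by
  classical
  have hone : ∀ (x y : V) (hxy : x ≠ y) (t : ℝ), ∑ᶠ e : (⊤ : SimpleGraph V).edgeSet,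
      (if (e : Sym2 V) = s(x, y) then t else 0) * cutVec ⊤ T e = t * sep T x y := by
    intro x y hxy t
    have he : s(x, y) ∈ (⊤ : SimpleGraph V).edgeSet := hxy
    rw [finsum_eq_single _ ⟨s(x, y), he⟩, if_pos rfl, cutVec_mk]
    intro e hne
    rw [if_neg fun h => hne (Subtype.ext h), zero_mul]
  rw [← hone u v huv, ← hone u w huw, ← hone v w hvw,
    ← finsum_add_distrib (Set.toFinite _) (Set.toFinite _),
    ← finsum_add_distrib (Set.toFinite _) (Set.toFinite _)]
  refine finsum_congr fun e => ?_
  simp only [onTriangle]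
  ring

end Complete

end Ineq

/-! ### Facets with a support node of low degree are triangle inequalities -/

namespace Ineq

theorem lhs_congr_of_sep {V : Type*} {G : SimpleGraph V} (I : Ineq G) {T T' : Set V}
    (h : ∀ x y, I.coeffAt x y ≠ 0 → sep T x y = sep T' x y) :
    I.lhs (cutVec G T) = I.lhs (cutVec G T') := by
  refine finsum_congr fun ⟨e, he⟩ => ?_
  induction e using Sym2.ind with
  | _ x y =>
    rw [cutVec_mk, cutVec_mk, ← I.coeffAt_mk he]
    by_cases h0 : I.coeffAt x y = 0
    · rw [h0, zero_mul, zero_mul]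
    · rw [h x y h0]

variable {V : Type*}

/-- `I` is, up to a positive factor, one of the four triangle inequalities on `u, v, w`, as far as
the coefficients are concerned. -/
def TriangleCoeffs (I : Ineq (⊤ : SimpleGraph V)) (u v w : V) : Prop :=
  u ≠ v ∧ u ≠ w ∧ v ≠ w ∧ ∃ (s : V → ℝ) (k : ℝ), IsSign s ∧ 0 < k ∧
    (∀ x ∈ ({u, v, w} : Set V), ∀ y ∈ ({u, v, w} : Set V), x ≠ y →
      I.coeffAt x y = k * (s x * s y)) ∧
    ∀ x y, I.coeffAt x y ≠ 0 → x ∈ ({u, v, w} : Set V)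

theorem TriangleCoeffs.rotate {I : Ineq (⊤ : SimpleGraph V)} {u v w : V}
    (h : I.TriangleCoeffs u v w) : I.TriangleCoeffs v w u := by
  obtain ⟨h1, h2, h3, h⟩ := h
  have : ({v, w, u} : Set V) = {u, v, w} := by ext; simp; tauto
  exact ⟨h3, h1.symm, h2.symm, this ▸ h⟩

theorem TriangleCoeffs.swap {I : Ineq (⊤ : SimpleGraph V)} {u v w : V}
    (h : I.TriangleCoeffs u v w) : I.TriangleCoeffs u w v := by
  obtain ⟨h1, h2, h3, h⟩ := h
  have : ({u, w, v} : Set V) = {u, v, w} := by ext; simp; tauto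
  exact ⟨h2, h1, h3.symm, this ▸ h⟩

theorem forall_triangle_pairs {u v w : V} {P : V → V → Prop} (hs : ∀ x y, P x y → P y x)
    (h1 : P u v) (h2 : P u w) (h3 : P v w) :
    ∀ x ∈ ({u, v, w} : Set V), ∀ y ∈ ({u, v, w} : Set V), x ≠ y → P x y := by
  rintro x (rfl | rfl | rfl) y (rfl | rfl | rfl) hxy
  all_goals first | exact absurd rfl hxy | assumption | (apply hs; assumption)

variable [Finite V]

/-- Up to complement a triangle has four cuts, with values $0$, $p+q$, $p+r$ and $q+r$. -/
theorem lhs_onTriangle_le {u v w : V} (huv : u ≠ v) (huw : u ≠ w) (hvw : v ≠ w) {p q r b : ℝ}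
    (h0 : 0 ≤ b) (h1 : p + q ≤ b) (h2 : p + r ≤ b) (h3 : q + r ≤ b) (T : Set V) :
    (onTriangle u v w p q r b).lhs (cutVec ⊤ T) ≤ (onTriangle u v w p q r b).bound := by
  rw [lhs_onTriangle huv huw hvw]
  change _ ≤ b
  by_cases hu : u ∈ T <;> by_cases hv : v ∈ T <;> by_cases hw : w ∈ T <;>
    simp [sep, hu, hv, hw] <;> linarith

theorem coeffAt_onTriangle {V : Type*} (u v w : V) (p q r b : ℝ) {x y : V} (hxy : x ≠ y) :
    (onTriangle u v w p q r b).coeffAt x y = open scoped Classical in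
      (if s(x, y) = s(u, v) then p else 0) + (if s(x, y) = s(u, w) then q else 0) +
      (if s(x, y) = s(v, w) then r else 0) := by
  have he : s(x, y) ∈ (⊤ : SimpleGraph V).edgeSet := hxy
  rw [coeffAt_mk _ he]
  rfl

theorem coeffAt_onTriangle_fst {V : Type*} {u v w : V} (huv : u ≠ v) (huw : u ≠ w) (hvw : v ≠ w)
    (p q r b : ℝ) : (onTriangle u v w p q r b).coeffAt u v = p := by
  rw [coeffAt_onTriangle _ _ _ _ _ _ _ huv]
  simp [huv, huw, hvw]

theorem coeffAt_onTriangle_snd {V : Type*} {u v w : V} (huv : u ≠ v) (huw : u ≠ w) (hvw : v ≠ w)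
    (p q r b : ℝ) : (onTriangle u v w p q r b).coeffAt u w = q := by
  rw [coeffAt_onTriangle _ _ _ _ _ _ _ huw]
  simp [huv, huw, hvw.symm]

theorem coeffAt_onTriangle_thd {V : Type*} {u v w : V} (huv : u ≠ v) (huw : u ≠ w) (hvw : v ≠ w)
    (p q r b : ℝ) : (onTriangle u v w p q r b).coeffAt v w = r := by
  rw [coeffAt_onTriangle _ _ _ _ _ _ _ hvw]
  simp [huv.symm, huw.symm, hvw, hvw.symm]

theorem coeffAt_sub {V : Type*} (f h : Ineq (⊤ : SimpleGraph V)) (b : ℝ) (x y : V) :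
    (⟨fun e => f.coeff e - h.coeff e, b⟩ : Ineq (⊤ : SimpleGraph V)).coeffAt x y =
      f.coeffAt x y - h.coeffAt x y := by
  simp only [coeffAt]
  split_ifs <;> simp

theorem coeffAt_congr {V : Type*} {G : SimpleGraph V} {I J : Ineq G} {l : ℝ}
    (h : ∀ e, I.coeff e = l * J.coeff e) (x y : V) : I.coeffAt x y = l * J.coeffAt x y := by
  simp only [coeffAt]
  split_ifs <;> simp [h]

/-- A facet inequality supported on a triangle is a triangle inequality. -/
theorem IsFacet.triangleCoeffs_onTriangle {u v w : V} (huv : u ≠ v) (huw : u ≠ w) (hvw : v ≠ w)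
    {p q r b : ℝ} (hf : (onTriangle u v w p q r b).IsFacet) :
    (onTriangle u v w p q r b).TriangleCoeffs u v w := by
  classical
  -- If a valid inequality on the triangle can be subtracted leaving a valid one, extremality makes
  -- it proportional to the facet.
  have key : ∀ p' q' r' b' : ℝ, p' ≠ 0 → 0 ≤ b' → p' + q' ≤ b' → p' + r' ≤ b' → q' + r' ≤ b' →
      b' ≤ b → p - p' + (q - q') ≤ b - b' → p - p' + (r - r') ≤ b - b' →
      q - q' + (r - r') ≤ b - b' → ∃ m : ℝ, 0 < m ∧ p = m * p' ∧ q = m * q' ∧ r = m * r' := by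
    intro p' q' r' b' hp' h0 h1 h2 h3 h4 h5 h6 h7
    obtain ⟨l, hl0, hl, -⟩ := hf.extremal (g := onTriangle u v w p' q' r' b')
      (h := onTriangle u v w (p - p') (q - q') (r - r') (b - b'))
      (lhs_onTriangle_le huv huw hvw h0 h1 h2 h3)
      (lhs_onTriangle_le huv huw hvw (sub_nonneg.2 h4) h5 h6 h7)
      (fun e => by simp only [onTriangle]; split_ifs <;> ring)
      (by simp only [onTriangle]; ring)
    have e1 := coeffAt_congr hl u v
    have e2 := coeffAt_congr hl u w
    have e3 := coeffAt_congr hl v w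
    simp only [coeffAt_onTriangle_fst huv huw hvw, coeffAt_onTriangle_snd huv huw hvw,
      coeffAt_onTriangle_thd huv huw hvw] at e1 e2 e3
    have hl' : l ≠ 0 := by rintro rfl; exact hp' (by rw [e1, zero_mul])
    refine ⟨l⁻¹, inv_pos.2 (lt_of_le_of_ne hl0 hl'.symm), ?_, ?_, ?_⟩
    · rw [e1, inv_mul_cancel_left₀ hl']
    · rw [e2, inv_mul_cancel_left₀ hl']
    · rw [e3, inv_mul_cancel_left₀ hl']
  have slack : ∀ T, p * sep T u v + q * sep T u w + r * sep T v w ≤ b := by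
    intro T
    rw [← lhs_onTriangle huv huw hvw]
    exact hf.tight.2 ⟨T, rfl⟩
  have b0 : 0 ≤ b := by simpa [sep] using slack ∅
  have bu : p + q ≤ b := by
    have := slack {u}
    simpa [sep, huv.symm, huw.symm] using this
  have bv : p + r ≤ b := by
    have := slack {v}
    simpa [sep, huv, hvw.symm] using this
  have bw : q + r ≤ b := by
    have := slack {w}
    simpa [sep, huw, hvw] using this
  have hres : ∃ k s₁ s₂ s₃ : ℝ, 0 < k ∧ (s₁ = 1 ∨ s₁ = -1) ∧ (s₂ = 1 ∨ s₂ = -1) ∧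
      (s₃ = 1 ∨ s₃ = -1) ∧ p = k * (s₁ * s₂) ∧ q = k * (s₁ * s₃) ∧ r = k * (s₂ * s₃) := by
    -- Each triangle inequality is tight at three of the four cuts and has slack 2 at the fourth. If
    -- the facet has positive slack at some cut, half that slack times the matching triangle
    -- inequality can be split off: the remainder has slack zero there and unchanged slack at the
    -- other cuts.
    by_cases c0 : 0 < b
    · obtain ⟨m, hm, h1, h2, h3⟩ := key (b / 2) (b / 2) (b / 2) b (by linarith) (by linarith)
        (by linarith) (by linarith) (by linarith) (by linarith) (by linarith) (by linarith)
        (by linarith)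
      exact ⟨m * (b / 2), 1, 1, 1, by positivity, by simp, by simp, by simp, by linarith,
        by linarith, by linarith⟩
    by_cases cu : p + q < b
    · obtain ⟨m, hm, h1, h2, h3⟩ := key (-(b - p - q) / 2) (-(b - p - q) / 2) ((b - p - q) / 2) 0
        (by linarith) (by linarith)
        (by linarith) (by linarith) (by linarith) (by linarith) (by linarith) (by linarith)
        (by linarith)
      have : 0 < b - p - q := by linarith
      exact ⟨m * ((b - p - q) / 2), -1, 1, 1, by positivity, by simp, by simp, by simp,
        by linarith, by linarith, by linarith⟩
    by_cases cv : p + r < b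
    · obtain ⟨m, hm, h1, h2, h3⟩ := key (-(b - p - r) / 2) ((b - p - r) / 2) (-(b - p - r) / 2) 0
        (by linarith) (by linarith)
        (by linarith) (by linarith) (by linarith) (by linarith) (by linarith) (by linarith)
        (by linarith)
      have : 0 < b - p - r := by linarith
      exact ⟨m * ((b - p - r) / 2), 1, -1, 1, by positivity, by simp, by simp, by simp,
        by linarith, by linarith, by linarith⟩
    by_cases cw : q + r < b
    · obtain ⟨m, hm, h1, h2, h3⟩ := key ((b - q - r) / 2) (-(b - q - r) / 2) (-(b - q - r) / 2) 0
        (by linarith) (by linarith)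
        (by linarith) (by linarith) (by linarith) (by linarith) (by linarith) (by linarith)
        (by linarith)
      have : 0 < b - q - r := by linarith
      exact ⟨m * ((b - q - r) / 2), 1, 1, -1, by positivity, by simp, by simp, by simp,
        by linarith, by linarith, by linarith⟩
    -- With no slack at any of the four cuts, $b$ and all coefficients vanish.
    exfalso
    refine hf.coeff_ne_zero (funext fun e => ?_)
    have hp : p = 0 := by linarith
    have hq : q = 0 := by linarith
    have hr : r = 0 := by linarith
    simp [onTriangle, hp, hq, hr]
  obtain ⟨k, s₁, s₂, s₃, hk, hs₁, hs₂, hs₃, hp, hq, hr⟩ := hres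
  refine ⟨huv, huw, hvw, fun x => if x = u then s₁ else if x = v then s₂ else s₃, k, ?_, hk, ?_, ?_⟩
  · intro x
    dsimp only
    split_ifs <;> assumption
  · refine forall_triangle_pairs (fun x y hxy => ?_) ?_ ?_ ?_
    · rw [coeffAt_comm, hxy, mul_comm (_ : ℝ) (ite _ _ _)]
    · rw [coeffAt_onTriangle_fst huv huw hvw, hp]
      simp [huv.symm]
    · rw [coeffAt_onTriangle_snd huv huw hvw, hq]
      simp [huw.symm, hvw.symm]
    · rw [coeffAt_onTriangle_thd huv huw hvw, hr]
      simp [huv.symm, huw.symm, hvw.symm]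
  · intro x y hne
    by_contra hx
    simp only [Set.mem_insert_iff, Set.mem_singleton_iff, not_or] at hx
    obtain ⟨h1, h2, h3⟩ := hx
    refine hne ?_
    by_cases hxy : x = y
    · subst hxy; simp
    · rw [coeffAt_onTriangle _ _ _ _ _ _ _ hxy]
      simp [h1, h2, h3]

/-- A facet inequality whose support has a node of degree one or two is a triangle inequality. -/
theorem IsFacet.triangleCoeffs {f : Ineq (⊤ : SimpleGraph V)} (hf : f.IsFacet) {u v w : V}
    (huv : u ≠ v) (huw : u ≠ w) (hvw : v ≠ w) (hsupp : ∀ t, t ≠ v → t ≠ w → f.coeffAt u t = 0)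
    (hne : f.coeffAt u v ≠ 0 ∨ f.coeffAt u w ≠ 0) : f.TriangleCoeffs u v w := by
  classical
  set p := f.coeffAt u v
  set q := f.coeffAt u w
  -- The largest contribution of `u` is `m₀` when `v` and `w` are on the same side and `m₁` when
  -- they are separated. The coefficient of `vw` in `h` evens out the two, so that `h` can be made
  -- an equality by placing `u` suitably.
  set m₀ := max 0 (p + q)
  set m₁ := max p q
  set h := onTriangle u v w p q (-(m₁ - m₀)) m₀
  have hhu : ∀ t, (⟨fun e => f.coeff e - h.coeff e, f.bound - h.bound⟩ :
      Ineq (⊤ : SimpleGraph V)).coeffAt u t = 0 := by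
    intro t
    rw [coeffAt_sub]
    by_cases h1 : t = v
    · subst h1; rw [coeffAt_onTriangle_fst huv huw hvw, sub_self]
    by_cases h2 : t = w
    · subst h2; rw [coeffAt_onTriangle_snd huv huw hvw, sub_self]
    by_cases h3 : u = t
    · subst h3; simp
    rw [hsupp t h1 h2, coeffAt_onTriangle _ _ _ _ _ _ _ h3]
    simp [h1, h2, huv, huw]
  have hopt : ∀ T : Set V, ∃ T' : Set V, (∀ x, x ≠ u → (x ∈ T' ↔ x ∈ T)) ∧
      h.lhs (cutVec ⊤ T') = h.bound := by
    intro T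
    have hput : ∀ b : Prop, ∃ T' : Set V, (∀ x, x ≠ u → (x ∈ T' ↔ x ∈ T)) ∧ (u ∈ T' ↔ b) :=
      fun b => ⟨{x | (x = u ∧ b) ∨ (x ≠ u ∧ x ∈ T)}, fun x hx => by simp [hx], by simp⟩
    have hb : h.bound = m₀ := rfl
    by_cases hv : v ∈ T <;> by_cases hw : w ∈ T
    · rcases le_total 0 (p + q) with hpq | hpq
      · obtain ⟨T', h1, h2⟩ := hput False
        refine ⟨T', h1, ?_⟩
        rw [lhs_onTriangle huv huw hvw, hb]
        simp [sep, h2, h1 v huv.symm, h1 w huw.symm, hv, hw, m₀, hpq]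
      · obtain ⟨T', h1, h2⟩ := hput True
        refine ⟨T', h1, ?_⟩
        rw [lhs_onTriangle huv huw hvw, hb]
        simp [sep, h2, h1 v huv.symm, h1 w huw.symm, hv, hw, m₀, hpq]
    · rcases le_total q p with hpq | hpq
      · obtain ⟨T', h1, h2⟩ := hput False
        refine ⟨T', h1, ?_⟩
        rw [lhs_onTriangle huv huw hvw, hb]
        simp [sep, h2, h1 v huv.symm, h1 w huw.symm, hv, hw, m₁, hpq]
      · obtain ⟨T', h1, h2⟩ := hput True
        refine ⟨T', h1, ?_⟩
        rw [lhs_onTriangle huv huw hvw, hb]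
        simp [sep, h2, h1 v huv.symm, h1 w huw.symm, hv, hw, m₁, hpq]
    · rcases le_total q p with hpq | hpq
      · obtain ⟨T', h1, h2⟩ := hput True
        refine ⟨T', h1, ?_⟩
        rw [lhs_onTriangle huv huw hvw, hb]
        simp [sep, h2, h1 v huv.symm, h1 w huw.symm, hv, hw, m₁, hpq]
      · obtain ⟨T', h1, h2⟩ := hput False
        refine ⟨T', h1, ?_⟩
        rw [lhs_onTriangle huv huw hvw, hb]
        simp [sep, h2, h1 v huv.symm, h1 w huw.symm, hv, hw, m₁, hpq]
    · rcases le_total 0 (p + q) with hpq | hpq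
      · obtain ⟨T', h1, h2⟩ := hput True
        refine ⟨T', h1, ?_⟩
        rw [lhs_onTriangle huv huw hvw, hb]
        simp [sep, h2, h1 v huv.symm, h1 w huw.symm, hv, hw, m₀, hpq]
      · obtain ⟨T', h1, h2⟩ := hput False
        refine ⟨T', h1, ?_⟩
        rw [lhs_onTriangle huv huw hvw, hb]
        simp [sep, h2, h1 v huv.symm, h1 w huw.symm, hv, hw, m₀, hpq]
  have hsub : ∀ x, (⟨fun e => f.coeff e - h.coeff e, f.bound - h.bound⟩ :
      Ineq (⊤ : SimpleGraph V)).lhs x = f.lhs x - h.lhs x := by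
    intro x
    simp only [lhs, sub_mul]
    exact finsum_sub_distrib (Set.toFinite _) (Set.toFinite _)
  obtain ⟨l, -, hl, hlb⟩ := hf.extremal (g := h)
    (h := ⟨fun e => f.coeff e - h.coeff e, f.bound - h.bound⟩)
    (lhs_onTriangle_le huv huw hvw (le_max_left _ _) (le_max_right _ _)
      (by
        rcases le_total q p with hpq | hpq
        · simp only [m₁, max_eq_left hpq]; linarith
        · simp only [m₁, max_eq_right hpq]; linarith)
      (by
        rcases le_total q p with hpq | hpq
        · simp only [m₁, max_eq_left hpq]; linarith
        · simp only [m₁, max_eq_right hpq]; linarith))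
    (by
      intro T
      -- The difference `f - h` does not involve `u`, so `u` may be moved to where `h` is an
      -- equality; there validity of `f` bounds it.
      obtain ⟨T', hT', hopt'⟩ := hopt T
      rw [lhs_congr_of_sep (T' := T'), hsub, hopt']
      · exact sub_le_sub_right (hf.tight.2 ⟨T', rfl⟩) _
      · intro x y hxy
        have hx : x ≠ u := by rintro rfl; exact hxy (hhu y)
        have hy : y ≠ u := by rintro rfl; rw [coeffAt_comm] at hxy; exact hxy (hhu x)
        unfold sep
        rw [hT' x hx, hT' y hy])
    (fun e => by ring) (by ring)
  have hl1 : l = 1 := by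
    have e1 := coeffAt_congr hl u v
    have e2 := coeffAt_congr hl u w
    rw [coeffAt_onTriangle_fst huv huw hvw] at e1
    rw [coeffAt_onTriangle_snd huv huw hvw] at e2
    rcases hne with hne | hne
    · exact mul_right_cancel₀ hne (by rw [one_mul]; exact e1.symm)
    · exact mul_right_cancel₀ hne (by rw [one_mul]; exact e2.symm)
  have hfh : f = h := by
    refine Ineq.ext (funext fun e => ?_) ?_
    · rw [hl e, hl1, one_mul]
    · rw [hlb, hl1, one_mul]
  rw [hfh] at hf ⊢
  exact hf.triangleCoeffs_onTriangle huv huw hvw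

theorem tight_triangleIneq {u v w : V} (huv : u ≠ v) (huw : u ≠ w) (hvw : v ≠ w) :
    (triangleIneq ⊤ u v w).Tight := by
  have h : (triangleIneq ⊤ u v w) = onTriangle u v w 1 (-1) (-1) 0 := by
    refine Ineq.ext (funext fun e => ?_) rfl
    have h1 : s(u, v) ≠ s(u, w) := by simp [huw, hvw]
    have h2 : s(u, v) ≠ s(v, w) := by simp [huv, huw, hvw]
    have h3 : s(u, w) ≠ s(v, w) := by simp [huv, huw]
    simp only [triangleIneq, onTriangle]
    by_cases c1 : (e : Sym2 V) = s(u, v)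
    · simp [c1, h1, h2]
    · by_cases c2 : (e : Sym2 V) = s(u, w)
      · simp [c2, h1.symm, h3]
      · by_cases c3 : (e : Sym2 V) = s(v, w)
        · simp [c3, h2.symm, h3.symm]
        · simp [c1, c2, c3]
  rw [h]
  refine ⟨⟨∅, ?_⟩, ?_⟩
  · simp only [lhs_onTriangle huv huw hvw, sep]
    simp [onTriangle]
  · rintro _ ⟨T, rfl⟩
    exact lhs_onTriangle_le huv huw hvw (by norm_num) (by norm_num) (by norm_num) (by norm_num) T

/-- `relabel` along the identity does nothing. -/
theorem relabel_refl {V : Type*} {G : SimpleGraph V} (I : Ineq G) :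
    I.relabel SimpleGraph.Iso.refl = I :=
  Ineq.ext (coeff_ext fun u v _ => coeffAt_relabel SimpleGraph.Iso.refl I u v) rfl

theorem coeffAt_triangleIneq {V : Type*} {u v w : V} {x y : V} (hxy : x ≠ y) :
    (triangleIneq ⊤ u v w).coeffAt x y = open scoped Classical in
      if s(x, y) = s(u, v) then 1 else if s(x, y) = s(u, w) ∨ s(x, y) = s(v, w) then -1 else 0 := by
  have he : s(x, y) ∈ (⊤ : SimpleGraph V).edgeSet := hxy
  rw [coeffAt_mk _ he]
  rfl

theorem TriangleCoeffs.isTriangleOn {f : Ineq (⊤ : SimpleGraph V)} {u v w : V}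
    (h : f.TriangleCoeffs u v w) (hf : f.Tight) : IsTriangleOn f u v w := by
  classical
  obtain ⟨huv, huw, hvw, s, k, hs, hk, hin, hout⟩ := h
  refine ⟨huv, huw, hvw, ?_⟩
  have hm : (triangleIneq ⊤ u v w).Matches f (SimpleGraph.Iso.refl : (⊤ : SimpleGraph V) ≃g ⊤) := by
    -- The coefficients $1,-1,-1$ of the reference inequality are products of the signs $1,1,-1$ at
    -- `u`, `v`, `w`; flipping the sign at `w` compensates for this.
    refine ⟨fun x => if x = w then -s x else s x, k, ?_, hk, ?_⟩
    · intro x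
      dsimp only
      split_ifs
      · rcases hs x with h | h <;> simp [h]
      · exact hs x
    · intro x y
      change f.coeffAt x y = _
      by_cases hxy : x = y
      · subst hxy; simp
      rw [coeffAt_triangleIneq hxy]
      by_cases hx : x ∈ ({u, v, w} : Set V)
      · by_cases hy : y ∈ ({u, v, w} : Set V)
        · rw [hin x hx y hy hxy]
          refine forall_triangle_pairs (P := fun x y => k * (s x * s y) =
            k * ((if x = w then -s x else s x) * (if y = w then -s y else s y)) *
              (if s(x, y) = s(u, v) then 1 else
                if s(x, y) = s(u, w) ∨ s(x, y) = s(v, w) then -1 else 0))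
            (fun x y hxy => ?_) ?_ ?_ ?_ x hx y hy hxy
          · rw [mul_comm (s y), hxy, mul_comm (ite (y = w) _ _), Sym2.eq_swap]
          · simp [huw, hvw]
          · simp [huw, huw.symm, hvw.symm]
          · simp [huv.symm, huw.symm, hvw, hvw.symm]
        · have : f.coeffAt x y = 0 := by
            by_contra h0
            rw [coeffAt_comm] at h0
            exact hy (hout _ _ h0)
          rw [this]
          simp only [Set.mem_insert_iff, Set.mem_singleton_iff, not_or] at hy
          simp [hy]
      · have : f.coeffAt x y = 0 := by
          by_contra h0
          exact hx (hout _ _ h0)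
        rw [this]
        simp only [Set.mem_insert_iff, Set.mem_singleton_iff, not_or] at hx
        simp [hx]
  obtain ⟨S, c, hc, h⟩ := hm.exists_eq (tight_triangleIneq huv huw hvw) hf
  exact ⟨S, c, hc, by rw [h, relabel_refl]⟩

end Ineq

/-! ### Old nodes, new nodes and the coefficients of the elimination -/

open Node

namespace Node

variable {α β : Type}

/-- The nodes form an option type over the disjoint union of the two parties. -/
def equivOption : Node α β ≃ Option (α ⊕ β) where
  toFun
    | X => none
    | A i => some (.inl i)
    | B j => some (.inr j)
  invFun
    | none => X
    | some (.inl i) => A i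
    | some (.inr j) => B j
  left_inv x := by cases x <;> rfl
  right_inv x := by rcases x with _ | _ | _ <;> rfl

theorem sum_node [Fintype α] [Fintype β] (g : Node α β → ℝ) :
    ∑ u, g u = g X + ∑ i, g (A i) + ∑ j, g (B j) := by
  rw [← Equiv.sum_comp equivOption.symm g, Fintype.sum_option, Fintype.sum_sum_type, add_assoc]
  rfl

theorem card_node [Fintype α] [Fintype β] :
    Fintype.card (Node α β) = Fintype.card α + Fintype.card β + 1 := by
  rw [Fintype.card_congr equivOption, Fintype.card_option, Fintype.card_sum]

theorem part_eq_zero {x : Node α β} : x.part = 0 ↔ x = X := by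
  cases x <;> simp [part]

theorem part_eq_one {x : Node α β} : x.part = 1 ↔ ∃ i, x = A i := by
  cases x <;> simp [part]

theorem part_eq_two {x : Node α β} : x.part = 2 ↔ ∃ j, x = B j := by
  cases x <;> simp [part]

end Node

/-- The exchange of the labels of the two parties. -/
def exchange : Equiv.Perm (Fin 3) := Equiv.swap 1 2

variable {nA nB : ℕ}

/-- The nodes of `K_n` among those of the tripartite graph. -/
def old : Node (Fin nA) (Fin nB) → Node (Fin nA ⊕ Pair nB) (Fin nB ⊕ Pair nA)
  | X => X
  | A i => A (.inl i)
  | B j => B (.inl j)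

/-- The new node attached to a pair of distinct nodes in the same party. -/
def mid : Node (Fin nA) (Fin nB) → Node (Fin nA) (Fin nB) →
    Node (Fin nA ⊕ Pair nB) (Fin nB ⊕ Pair nA)
  | A i, A i' => if h : i < i' then B (.inr ⟨(i, i'), h⟩)
      else if h : i' < i then B (.inr ⟨(i', i), h⟩) else X
  | B j, B j' => if h : j < j' then A (.inr ⟨(j, j'), h⟩)
      else if h : j' < j then A (.inr ⟨(j', j), h⟩) else X
  | _, _ => X

/-- Two distinct nodes of the same party. -/
def Mates (u v : Node (Fin nA) (Fin nB)) : Prop := u ≠ v ∧ u.part = v.part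

theorem Mates.symm {u v : Node (Fin nA) (Fin nB)} (h : Mates u v) : Mates v u :=
  ⟨h.1.symm, h.2.symm⟩

theorem mates_cases {u v : Node (Fin nA) (Fin nB)} (h : Mates u v) :
    (∃ i i', i ≠ i' ∧ u = A i ∧ v = A i') ∨ (∃ j j', j ≠ j' ∧ u = B j ∧ v = B j') := by
  obtain ⟨h1, h2⟩ := h
  cases u <;> cases v <;> simp_all [part]

theorem mid_A_of_lt {i i' : Fin nA} (h : i < i') :
    (mid (A i) (A i') : Node (Fin nA ⊕ Pair nB) _) = B (.inr ⟨(i, i'), h⟩) := by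
  simp [mid, h]

theorem mid_B_of_lt {j j' : Fin nB} (h : j < j') :
    (mid (B j) (B j') : Node _ (Fin nB ⊕ Pair nA)) = A (.inr ⟨(j, j'), h⟩) := by
  simp [mid, h]

theorem mid_comm (u v : Node (Fin nA) (Fin nB)) : mid u v = mid v u := by
  cases u <;> cases v <;> simp only [mid]
  · rename_i i i'
    rcases lt_trichotomy i i' with h | rfl | h
    · simp [h, h.not_gt]
    · rfl
    · simp [h, h.not_gt]
  · rename_i i i'
    rcases lt_trichotomy i i' with h | rfl | h
    · simp [h, h.not_gt]
    · rfl
    · simp [h, h.not_gt]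

/-- To prove a symmetric statement on all pairs of mates, order them. -/
theorem Mates.ordered {P : Node (Fin nA) (Fin nB) → Node (Fin nA) (Fin nB) → Prop}
    (hs : ∀ u v, P u v → P v u) (hA : ∀ i i', i < i' → P (A i) (A i'))
    (hB : ∀ j j', j < j' → P (B j) (B j')) {u v : Node (Fin nA) (Fin nB)} (h : Mates u v) :
    P u v := by
  rcases mates_cases h with ⟨i, i', hi, rfl, rfl⟩ | ⟨i, i', hi, rfl, rfl⟩
  · rcases lt_or_gt_of_ne hi with h | h
    · exact hA _ _ h
    · exact hs _ _ (hA _ _ h)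
  · rcases lt_or_gt_of_ne hi with h | h
    · exact hB _ _ h
    · exact hs _ _ (hB _ _ h)

theorem old_injective : Function.Injective (old (nA := nA) (nB := nB)) := by
  intro u v h
  cases u <;> cases v <;> simp_all [old]

@[simp] theorem part_old (u : Node (Fin nA) (Fin nB)) : (old u).part = u.part := by
  cases u <;> rfl

theorem part_mid {u v : Node (Fin nA) (Fin nB)} (h : Mates u v) :
    (mid u v).part = exchange u.part := by
  refine Mates.ordered (P := fun u v => u.part = v.part → (mid u v).part = exchange u.part)
    (fun u v h h' => by rw [mid_comm, h h'.symm, h']) ?_ ?_ h h.2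
  · intro i i' h _
    rw [mid_A_of_lt h]; rfl
  · intro i i' h _
    rw [mid_B_of_lt h]; rfl

theorem mid_ne_old {u v : Node (Fin nA) (Fin nB)} (h : Mates u v)
    (z : Node (Fin nA) (Fin nB)) : mid u v ≠ old z := by
  refine Mates.ordered (P := fun u v => mid u v ≠ old z)
    (fun u v h => by rwa [mid_comm]) ?_ ?_ h
  · intro i i' h
    rw [mid_A_of_lt h]; cases z <;> simp [old]
  · intro i i' h
    rw [mid_B_of_lt h]; cases z <;> simp [old]

theorem exists_old_or_mid (x : Node (Fin nA ⊕ Pair nB) (Fin nB ⊕ Pair nA)) :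
    (∃ u, x = old u) ∨ ∃ u v, Mates u v ∧ x = mid u v := by
  rcases x with _ | (i | ⟨⟨j, j'⟩, h⟩) | (j | ⟨⟨i, i'⟩, h⟩)
  · exact Or.inl ⟨X, rfl⟩
  · exact Or.inl ⟨A i, rfl⟩
  · exact Or.inr ⟨B j, B j', ⟨by simpa using ne_of_lt h, rfl⟩, (mid_B_of_lt h).symm⟩
  · exact Or.inl ⟨B j, rfl⟩
  · exact Or.inr ⟨A i, A i', ⟨by simpa using ne_of_lt h, rfl⟩, (mid_A_of_lt h).symm⟩

theorem mid_inj {u v u' v' : Node (Fin nA) (Fin nB)} (h : Mates u v) (h' : Mates u' v')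
    (he : mid u v = mid u' v') : (u = u' ∧ v = v') ∨ (u = v' ∧ v = u') := by
  refine Mates.ordered
    (P := fun u v => mid u v = mid u' v' → (u = u' ∧ v = v') ∨ (u = v' ∧ v = u'))
    (fun u v h h' => by rw [mid_comm] at h'; have := h h'; tauto) ?_ ?_ h he
  · intro i i' hi
    refine Mates.ordered
      (P := fun u' v' => mid (A i) (A i') = mid u' v' →
        (A i = u' ∧ A i' = v') ∨ (A i = v' ∧ A i' = u'))
      (fun u v h h' => by rw [mid_comm u v] at *; have := h h'; tauto) ?_ ?_ h'
    · intro k k' hk he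
      rw [mid_A_of_lt hi, mid_A_of_lt hk] at he
      simp_all
    · intro k k' hk he
      rw [mid_A_of_lt hi, mid_B_of_lt hk] at he
      simp_all
  · intro i i' hi
    refine Mates.ordered
      (P := fun u' v' => mid (B i) (B i') = mid u' v' →
        (B i = u' ∧ B i' = v') ∨ (B i = v' ∧ B i' = u'))
      (fun u v h h' => by rw [mid_comm u v] at *; have := h h'; tauto) ?_ ?_ h'
    · intro k k' hk he
      rw [mid_B_of_lt hi, mid_A_of_lt hk] at he
      simp_all
    · intro k k' hk he
      rw [mid_B_of_lt hi, mid_B_of_lt hk] at he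
      simp_all

section Coefficients

variable (f : Ineq (completeK nA nB))

theorem elimOriented_of_part_eq {x y : Node (Fin nA ⊕ Pair nB) (Fin nB ⊕ Pair nA)}
    (h : x.part = y.part) : elimOriented f x y = 0 := by
  cases x <;> cases y <;> simp_all [part, elimOriented]

theorem coeffAt_triElim (x y : Node (Fin nA ⊕ Pair nB) (Fin nB ⊕ Pair nA)) :
    (triElim f).coeffAt x y = elimOriented f x y + elimOriented f y x := by
  by_cases h : (elimK nA nB).Adj x y
  · rw [Ineq.coeffAt_mk _ ((elimK nA nB).mem_edgeSet.2 h)]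
    rfl
  · rw [Ineq.coeffAt_of_not_adj _ h]
    have : x.part = y.part := by simpa [tripartite] using h
    rw [elimOriented_of_part_eq f this, elimOriented_of_part_eq f this.symm, add_zero]

theorem triElim_of_part_eq {x y : Node (Fin nA ⊕ Pair nB) (Fin nB ⊕ Pair nA)}
    (h : x.part = y.part) : (triElim f).coeffAt x y = 0 := by
  rw [coeffAt_triElim, elimOriented_of_part_eq f h, elimOriented_of_part_eq f h.symm, add_zero]

theorem triElim_old_old {u v : Node (Fin nA) (Fin nB)} (h : u.part ≠ v.part) :
    (triElim f).coeffAt (old u) (old v) = f.coeffAt u v := by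
  rw [coeffAt_triElim]
  cases u <;> cases v <;> simp_all [part, old, elimOriented] <;> exact f.coeffAt_comm _ _

theorem triElim_mid_mid {u v u' v' : Node (Fin nA) (Fin nB)} (h : Mates u v)
    (h' : Mates u' v') : (triElim f).coeffAt (mid u v) (mid u' v') = 0 := by
  rw [coeffAt_triElim]
  rcases hx : mid u v with _ | (i | p) | (i | p) <;> rcases hy : mid u' v' with _ | (j | q) | (j | q)
  all_goals first
    | exact absurd hx (mid_ne_old h X)
    | exact absurd hx (mid_ne_old h (A i))
    | exact absurd hx (mid_ne_old h (B i))
    | exact absurd hy (mid_ne_old h' X)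
    | exact absurd hy (mid_ne_old h' (A j))
    | exact absurd hy (mid_ne_old h' (B j))
    | simp [elimOriented]

theorem triElim_old_mid {u v z : Node (Fin nA) (Fin nB)} (h : Mates u v) (hu : z ≠ u)
    (hv : z ≠ v) : (triElim f).coeffAt (old z) (mid u v) = 0 := by
  refine Mates.ordered
    (P := fun u v => z ≠ u → z ≠ v → (triElim f).coeffAt (old z) (mid u v) = 0)
    (fun u v h h1 h2 => by rw [mid_comm]; exact h h2 h1) ?_ ?_ h hu hv
  · intro i i' hi h1 h2
    rw [mid_A_of_lt hi, coeffAt_triElim]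
    cases z <;> simp_all [old, elimOriented]
  · intro i i' hi h1 h2
    rw [mid_B_of_lt hi, coeffAt_triElim]
    cases z <;> simp_all [old, elimOriented]

/-- The coefficients at the new node are $a$ and $-|a|$, but the order of the indices decides which
end gets which. Only symmetric information is recorded here; it still determines $a$, as $x\mapsto
x|x|$ is injective. -/
theorem triElim_mid_spec {u v : Node (Fin nA) (Fin nB)} (h : Mates u v) :
    |(triElim f).coeffAt (old u) (mid u v)| = |f.coeffAt u v| ∧
    |(triElim f).coeffAt (old v) (mid u v)| = |f.coeffAt u v| ∧
    (triElim f).coeffAt (old u) (mid u v) * (triElim f).coeffAt (old v) (mid u v) =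
      -(f.coeffAt u v * |f.coeffAt u v|) := by
  refine Mates.ordered (P := fun u v =>
      |(triElim f).coeffAt (old u) (mid u v)| = |f.coeffAt u v| ∧
      |(triElim f).coeffAt (old v) (mid u v)| = |f.coeffAt u v| ∧
      (triElim f).coeffAt (old u) (mid u v) * (triElim f).coeffAt (old v) (mid u v) =
      -(f.coeffAt u v * |f.coeffAt u v|)) ?_ ?_ ?_ h
  · rintro u v ⟨h1, h2, h3⟩
    rw [mid_comm v u, f.coeffAt_comm v u]
    exact ⟨h2, h1, by rw [mul_comm, h3]⟩
  · intro i i' hi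
    rw [mid_A_of_lt hi, coeffAt_triElim, coeffAt_triElim]
    simp [old, elimOriented, hi.ne']
  · intro i i' hi
    rw [mid_B_of_lt hi, coeffAt_triElim, coeffAt_triElim]
    simp [old, elimOriented, hi.ne']

end Coefficients

/-! ### Triangular elimination preserves tightness -/

section Tightness

theorem sum_pairs {n : ℕ} {g : Fin n → Fin n → ℝ} (hs : ∀ i j, g i j = g j i)
    (h0 : ∀ i, g i i = 0) : ∑ i, ∑ j, g i j = 2 * ∑ p : Pair n, g p.1.1 p.1.2 := by
  have h1 : ∑ p : Pair n, g p.1.1 p.1.2 = ∑ x : Fin n × Fin n with x.1 < x.2, g x.1 x.2 :=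
    (Finset.sum_subtype _ (by simp) fun x : Fin n × Fin n => g x.1 x.2).symm
  have h2 : ∑ x : Fin n × Fin n with x.2 < x.1, g x.1 x.2 =
      ∑ x : Fin n × Fin n with x.1 < x.2, g x.1 x.2 := by
    refine Finset.sum_bij (fun x _ => x.swap) ?_ ?_ ?_ ?_
    · intro x hx; simpa using hx
    · intro x _ y _ h; exact Prod.swap_injective h
    · intro x hx; exact ⟨x.swap, by simpa using hx, by simp⟩
    · intro x _; exact hs _ _
  rw [← Fintype.sum_prod_type' (f := g), h1, two_mul]
  conv_rhs => lhs; rw [← h2]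
  rw [Finset.sum_filter, Finset.sum_filter, ← Finset.sum_add_distrib]
  refine Finset.sum_congr rfl ?_
  rintro ⟨i, j⟩ _
  rcases lt_trichotomy i j with h | rfl | h
  · simp [h, h.not_gt]
  · simp [h0]
  · simp [h, h.not_gt]

/-- The left-hand side of an inequality for `K_n` at a cut, with each edge listed once. -/
theorem lhs_completeK (f : Ineq (completeK nA nB)) (T : Set (Node (Fin nA) (Fin nB))) :
    f.lhs (cutVec _ T) =
      ∑ i, f.coeffAt X (A i) * sep T X (A i) + ∑ j, f.coeffAt X (B j) * sep T X (B j) +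
      ∑ i, ∑ j, f.coeffAt (A i) (B j) * sep T (A i) (B j) +
      ∑ p : Pair nA, f.coeffAt (A p.1.1) (A p.1.2) * sep T (A p.1.1) (A p.1.2) +
      ∑ p : Pair nB, f.coeffAt (B p.1.1) (B p.1.2) * sep T (B p.1.1) (B p.1.2) := by
  have h := f.two_mul_lhs_cutVec T
  have hs : ∀ u v, f.coeffAt u v * sep T u v = f.coeffAt v u * sep T v u := fun u v => by
    rw [f.coeffAt_comm, sep_comm]
  simp only [sum_node, Finset.sum_add_distrib] at h
  rw [sum_pairs (fun i j => hs (A i) (A j)) (by simp),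
    sum_pairs (fun i j => hs (B i) (B j)) (by simp),
    Finset.sum_comm (f := fun j i => f.coeffAt (B j) (A i) * sep T (B j) (A i))] at h
  simp only [hs (A _) X, hs (B _) X, hs (B _) (A _), sep_self, mul_zero] at h
  linarith

theorem lhs_triElim (f : Ineq (completeK nA nB))
    (T : Set (Node (Fin nA ⊕ Pair nB) (Fin nB ⊕ Pair nA))) :
    (triElim f).lhs (cutVec _ T) =
      ∑ i, f.coeffAt X (A i) * sep T X (old (A i)) +
      ∑ j, f.coeffAt X (B j) * sep T X (old (B j)) +
      ∑ i, ∑ j, f.coeffAt (A i) (B j) * sep T (old (A i)) (old (B j)) +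
      ∑ p : Pair nA, (f.coeffAt (A p.1.1) (A p.1.2) * sep T (old (A p.1.1)) (B (.inr p)) -
        |f.coeffAt (A p.1.1) (A p.1.2)| * sep T (old (A p.1.2)) (B (.inr p))) +
      ∑ p : Pair nB, (f.coeffAt (B p.1.1) (B p.1.2) * sep T (old (B p.1.1)) (A (.inr p)) -
        |f.coeffAt (B p.1.1) (B p.1.2)| * sep T (old (B p.1.2)) (A (.inr p))) := by
  have h : (triElim f).lhs (cutVec _ T) = ∑ x, ∑ y, elimOriented f x y * sep T x y := by
    have h := (triElim f).two_mul_lhs_cutVec T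
    simp only [coeffAt_triElim, add_mul, Finset.sum_add_distrib] at h
    rw [Finset.sum_comm (f := fun x y => elimOriented f y x * sep T x y)] at h
    have h' : ∑ y, ∑ x, elimOriented f y x * sep T x y =
        ∑ x, ∑ y, elimOriented f x y * sep T x y :=
      Finset.sum_congr rfl fun y _ => Finset.sum_congr rfl fun x _ => by rw [sep_comm]
    linarith
  have hpick : ∀ {n : ℕ} (p : Pair n) (a b : ℝ) (t : Fin n → ℝ),
      ∑ i, (if i = p.1.1 then a else if i = p.1.2 then -b else 0) * t i =
        a * t p.1.1 - b * t p.1.2 := by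
    intro n p a b t
    have hne : p.1.1 ≠ p.1.2 := p.2.ne
    have : ∀ i, (if i = p.1.1 then a else if i = p.1.2 then -b else 0) * t i =
        (if i = p.1.1 then a * t i else 0) + (if i = p.1.2 then -b * t i else 0) := by
      intro i
      by_cases h1 : i = p.1.1
      · simp [h1, hne]
      · simp [h1]
    simp only [this, Finset.sum_add_distrib, Finset.sum_ite_eq', Finset.mem_univ, if_true]
    ring
  have hA : ∀ p : Pair nA, f.coeffAt (A p.1.1) (A p.1.2) * sep T (old (A p.1.1)) (B (.inr p)) -
        |f.coeffAt (A p.1.1) (A p.1.2)| * sep T (old (A p.1.2)) (B (.inr p)) =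
      ∑ i, elimOriented f (A (.inl i)) (B (.inr p)) * sep T (A (.inl i)) (B (.inr p)) :=
    fun p => (hpick p _ _ fun i => sep T (old (A i)) (B (.inr p))).symm
  have hB : ∀ p : Pair nB, f.coeffAt (B p.1.1) (B p.1.2) * sep T (old (B p.1.1)) (A (.inr p)) -
        |f.coeffAt (B p.1.1) (B p.1.2)| * sep T (old (B p.1.2)) (A (.inr p)) =
      ∑ j, elimOriented f (A (.inr p)) (B (.inl j)) * sep T (A (.inr p)) (B (.inl j)) :=
    fun p => by
      rw [← hpick p _ _ fun i => sep T (old (B i)) (A (.inr p))]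
      exact Finset.sum_congr rfl fun j _ => by rw [sep_comm]; rfl
  rw [h, Finset.sum_congr rfl fun p _ => hA p, Finset.sum_congr rfl fun p _ => hB p,
    Finset.sum_comm]
  simp only [sum_node, Fintype.sum_sum_type, Finset.sum_add_distrib]
  simp only [elimOriented, zero_mul, Finset.sum_const_zero, old]
  rw [Finset.sum_comm (s := Finset.univ (α := Fin nA)) (t := Finset.univ (α := Fin nB)),
    Finset.sum_comm (s := Finset.univ (α := Fin nB)) (t := Finset.univ (α := Pair nB))]
  ring

theorem sep_preimage {V W : Type*} (g : V → W) (T : Set W) (u v : V) :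
    sep (g ⁻¹' T) u v = sep T (g u) (g v) := rfl

/-- The basic triangle estimate behind triangular elimination. -/
theorem sub_abs_le_sep {V : Type*} (T : Set V) (x y z : V) (a : ℝ) :
    a * sep T x z - |a| * sep T y z ≤ a * sep T x y := by
  have h1 := le_abs_self a
  have h2 := neg_abs_le a
  by_cases hx : x ∈ T <;> by_cases hy : y ∈ T <;> by_cases hz : z ∈ T <;>
    simp [sep, hx, hy, hz] <;> linarith

/-- Every cut of `K_n` extends to the tripartite graph, giving a new node of a pair the side of
the second node of the pair. -/
def extendCut (S : Set (Node (Fin nA) (Fin nB))) :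
    Set (Node (Fin nA ⊕ Pair nB) (Fin nB ⊕ Pair nA)) :=
  {x | match x with
    | X => X ∈ S
    | A (.inl i) => A i ∈ S
    | B (.inl j) => B j ∈ S
    | A (.inr p) => B p.1.2 ∈ S
    | B (.inr p) => A p.1.2 ∈ S}

/-- The bound is attained at `extendCut` of an optimal cut, where the terms $-|a|x$ vanish.
Conversely, each pair of terms at a new node is at most the term it replaced (`sub_abs_le_sep`), so
a cut does no better than its restriction to the old nodes. -/
theorem Ineq.Tight.triElim {f : Ineq (completeK nA nB)} (hf : f.Tight) :
    (triElim f).Tight := by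
  obtain ⟨⟨S, hS⟩, hub⟩ := hf
  refine ⟨⟨extendCut S, ?_⟩, ?_⟩
  · simp only at hS
    change _ = f.bound
    rw [← hS, lhs_completeK]
    simp only [lhs_triElim]
    have h0 : ∀ x y : Node (Fin nA ⊕ Pair nB) (Fin nB ⊕ Pair nA),
        (x ∈ extendCut S ↔ y ∈ extendCut S) → sep (extendCut S) x y = 0 :=
      fun x y h => if_pos h
    congr 1
    · congr 1
      refine Finset.sum_congr rfl fun p _ => ?_
      rw [h0 (old (A p.1.2)) (B (.inr p)) Iff.rfl, mul_zero, sub_zero]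
      rfl
    · refine Finset.sum_congr rfl fun p _ => ?_
      rw [h0 (old (B p.1.2)) (A (.inr p)) Iff.rfl, mul_zero, sub_zero]
      rfl
  · rintro _ ⟨T, rfl⟩
    refine le_trans ?_ (hub ⟨old ⁻¹' T, rfl⟩)
    simp only [lhs_triElim, lhs_completeK, sep_preimage]
    refine add_le_add (add_le_add le_rfl ?_) ?_ <;>
      exact Finset.sum_le_sum fun p _ => sub_abs_le_sep _ _ _ _ _

end Tightness

/-! ### Lifting permutations of $K_n$ to the tripartite graph -/

section Parts

variable {α β : Type}

/-- The map `g` permutes the three classes according to `π`. -/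
def PartsVia (π : Equiv.Perm (Fin 3)) (g : Node α β → Node α β) : Prop :=
  ∀ u, (g u).part = π u.part

theorem PartsVia.map_X {π : Equiv.Perm (Fin 3)} {g : Node α β → Node α β} (h : PartsVia π g)
    (hπ : π = 1 ∨ π = exchange) : g X = X := by
  rw [← part_eq_zero, h X]
  rcases hπ with rfl | rfl <;> rfl

theorem mem_alice {u : Node α β} : u ∈ Node.alice ↔ u.part = 1 := by
  cases u <;> simp [Node.alice, part]

theorem mem_bob {u : Node α β} : u ∈ Node.bob ↔ u.part = 2 := by
  cases u <;> simp [Node.bob, part]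

end Parts

theorem RespectsParties.exists_partsVia {τ : completeK nA nB ≃g completeK nA nB}
    (h : RespectsParties τ) : ∃ π : Equiv.Perm (Fin 3), (π = 1 ∨ π = exchange) ∧ PartsVia π τ := by
  obtain ⟨hX, ⟨hA, hB⟩ | ⟨hA, hB⟩⟩ := h
  · refine ⟨1, Or.inl rfl, ?_⟩
    rintro (_ | i | j)
    · rw [hX]; rfl
    · exact mem_alice.1 (hA ▸ Set.mem_image_of_mem τ (mem_alice.2 rfl))
    · exact mem_bob.1 (hB ▸ Set.mem_image_of_mem τ (mem_bob.2 rfl))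
  · refine ⟨exchange, Or.inr rfl, ?_⟩
    rintro (_ | i | j)
    · rw [hX]; rfl
    · exact mem_bob.1 (hA ▸ Set.mem_image_of_mem τ (mem_alice.2 rfl))
    · exact mem_alice.1 (hB ▸ Set.mem_image_of_mem τ (mem_bob.2 rfl))

theorem PartsVia.respectsParties {π : Equiv.Perm (Fin 3)} (hπ : π = 1 ∨ π = exchange)
    {τ : completeK nA nB ≃g completeK nA nB} (h : PartsVia π τ) : RespectsParties τ := by
  have himg : ∀ (P Q : Set (Node (Fin nA) (Fin nB))), (∀ u, τ u ∈ Q ↔ u ∈ P) → τ '' P = Q := by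
    intro P Q hPQ
    ext x
    constructor
    · rintro ⟨u, hu, rfl⟩; exact (hPQ u).2 hu
    · intro hx
      obtain ⟨u, rfl⟩ := τ.surjective x
      exact ⟨u, (hPQ u).1 hx, rfl⟩
  refine ⟨h.map_X hπ, ?_⟩
  rcases hπ with rfl | rfl
  · exact Or.inl ⟨himg _ _ fun u => by simp [mem_alice, h u],
      himg _ _ fun u => by simp [mem_bob, h u]⟩
  · refine Or.inr ⟨himg _ _ fun u => ?_, himg _ _ fun u => ?_⟩ <;>
      simp only [mem_alice, mem_bob, h u] <;> generalize u.part = p <;> revert p <;> decide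

/-- The map induced on the nodes of the tripartite graph. -/
def liftNode (τ : Node (Fin nA) (Fin nB) → Node (Fin nA) (Fin nB)) :
    Node (Fin nA ⊕ Pair nB) (Fin nB ⊕ Pair nA) → Node (Fin nA ⊕ Pair nB) (Fin nB ⊕ Pair nA)
  | X => old (τ X)
  | A (.inl i) => old (τ (A i))
  | B (.inl j) => old (τ (B j))
  | A (.inr p) => mid (τ (B p.1.1)) (τ (B p.1.2))
  | B (.inr p) => mid (τ (A p.1.1)) (τ (A p.1.2))

theorem liftNode_old (τ : Node (Fin nA) (Fin nB) → Node (Fin nA) (Fin nB))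
    (u : Node (Fin nA) (Fin nB)) : liftNode τ (old u) = old (τ u) := by
  cases u <;> rfl

theorem liftNode_mid (τ : Node (Fin nA) (Fin nB) → Node (Fin nA) (Fin nB))
    {u v : Node (Fin nA) (Fin nB)} (h : Mates u v) :
    liftNode τ (mid u v) = mid (τ u) (τ v) := by
  refine Mates.ordered (P := fun u v => liftNode τ (mid u v) = mid (τ u) (τ v)) ?_ ?_ ?_ h
  · intro u v h
    rw [mid_comm, h, mid_comm]
  · intro i i' hi
    rw [mid_A_of_lt hi]; rfl
  · intro i i' hi
    rw [mid_B_of_lt hi]; rfl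

theorem Mates.map {π : Equiv.Perm (Fin 3)} {τ : Node (Fin nA) (Fin nB) → Node (Fin nA) (Fin nB)}
    (hτ : Function.Injective τ) (h : PartsVia π τ) {u v : Node (Fin nA) (Fin nB)}
    (huv : Mates u v) : Mates (τ u) (τ v) :=
  ⟨hτ.ne huv.1, by rw [h, h, huv.2]⟩

theorem liftNode_injective {π : Equiv.Perm (Fin 3)}
    {τ : Node (Fin nA) (Fin nB) → Node (Fin nA) (Fin nB)}
    (hτ : Function.Injective τ) (h : PartsVia π τ) : Function.Injective (liftNode τ) := by
  intro x y hxy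
  rcases exists_old_or_mid x with ⟨u, rfl⟩ | ⟨u, v, huv, rfl⟩ <;>
    rcases exists_old_or_mid y with ⟨u', rfl⟩ | ⟨u', v', huv', rfl⟩
  · rw [liftNode_old, liftNode_old] at hxy
    rw [hτ (old_injective hxy)]
  · rw [liftNode_old, liftNode_mid τ huv'] at hxy
    exact absurd hxy.symm (mid_ne_old (huv'.map hτ h) _)
  · rw [liftNode_old, liftNode_mid τ huv] at hxy
    exact absurd hxy (mid_ne_old (huv.map hτ h) _)
  · rw [liftNode_mid τ huv, liftNode_mid τ huv'] at hxy
    rcases mid_inj (huv.map hτ h) (huv'.map hτ h) hxy with ⟨h1, h2⟩ | ⟨h1, h2⟩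
    · rw [hτ h1, hτ h2]
    · rw [hτ h1, hτ h2, mid_comm]

theorem partsVia_liftNode {π : Equiv.Perm (Fin 3)} (hπ : π = 1 ∨ π = exchange)
    {τ : Node (Fin nA) (Fin nB) → Node (Fin nA) (Fin nB)}
    (hτ : Function.Injective τ) (h : PartsVia π τ) : PartsVia π (liftNode τ) := by
  intro x
  rcases exists_old_or_mid x with ⟨u, rfl⟩ | ⟨u, v, huv, rfl⟩
  · rw [liftNode_old, part_old, part_old, h]
  · rw [liftNode_mid τ huv, part_mid huv, part_mid (huv.map hτ h), h]
    rcases hπ with rfl | rfl <;> rfl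

/-- The automorphism of the tripartite graph induced by a permutation of the nodes of `K_n`. -/
noncomputable def liftIso {π : Equiv.Perm (Fin 3)} (hπ : π = 1 ∨ π = exchange)
    {τ : Node (Fin nA) (Fin nB) → Node (Fin nA) (Fin nB)}
    (hτ : Function.Injective τ) (h : PartsVia π τ) : elimK nA nB ≃g elimK nA nB where
  toEquiv := Equiv.ofBijective (liftNode τ)
    (Finite.injective_iff_bijective.1 (liftNode_injective hτ h))
  map_rel_iff' := by
    intro x y
    simp [tripartite, partsVia_liftNode hπ hτ h x, partsVia_liftNode hπ hτ h y]

/-- Absolute values give one sign for each number. If the two signs differ, equal products force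
$pq=0$, and the sign attached to a zero is free. -/
theorem exists_sign {p q p' q' : ℝ} (hp : |p'| = |p|) (hq : |q'| = |q|) (h : p' * q' = p * q) :
    ∃ η : ℝ, (η = 1 ∨ η = -1) ∧ p' = η * p ∧ q' = η * q := by
  rcases abs_eq_abs.1 hp with rfl | rfl <;> rcases abs_eq_abs.1 hq with rfl | rfl
  · exact ⟨1, Or.inl rfl, by ring, by ring⟩
  · have h0 : p' * q = 0 := by linarith
    rcases mul_eq_zero.1 h0 with rfl | rfl
    · exact ⟨-1, Or.inr rfl, by ring, by ring⟩
    · exact ⟨1, Or.inl rfl, by ring, by ring⟩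
  · have h0 : p * q' = 0 := by linarith
    rcases mul_eq_zero.1 h0 with rfl | rfl
    · exact ⟨1, Or.inl rfl, by ring, by ring⟩
    · exact ⟨-1, Or.inr rfl, by ring, by ring⟩
  · exact ⟨-1, Or.inr rfl, by ring, by ring⟩

theorem IsSign.abs {V : Type*} {s : V → ℝ} (h : IsSign s) (v : V) : |s v| = 1 := by
  rcases h v with h | h <;> simp [h]

/-- Triangular elimination respects permutations and sign changes. -/
theorem Ineq.Matches.triElim {f f' : Ineq (completeK nA nB)} {π : Equiv.Perm (Fin 3)}
    {τ : Node (Fin nA) (Fin nB) → Node (Fin nA) (Fin nB)}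
    (hτ : Function.Injective τ) (hp : PartsVia π τ) (h : f.Matches f' τ) :
    (triElim f).Matches (triElim f') (liftNode τ) := by
  obtain ⟨s, c, hs, hc, h⟩ := h
  -- An old node keeps its sign; a new node needs a single `η` that works for both of its edges.
  have hex : ∀ x : Node (Fin nA ⊕ Pair nB) (Fin nB ⊕ Pair nA), ∃ η : ℝ, (η = 1 ∨ η = -1) ∧
      (∀ u, x = old u → η = s u) ∧ ∀ u v, Mates u v → x = mid u v →
        (CutBell.triElim f').coeffAt (old (τ u)) (mid (τ u) (τ v)) =
          c * (s u * η) * (CutBell.triElim f).coeffAt (old u) (mid u v) ∧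
        (CutBell.triElim f').coeffAt (old (τ v)) (mid (τ u) (τ v)) =
          c * (s v * η) * (CutBell.triElim f).coeffAt (old v) (mid u v) := by
    intro x
    rcases exists_old_or_mid x with ⟨u, rfl⟩ | ⟨u, v, huv, rfl⟩
    · exact ⟨s u, hs u, fun v hv => by rw [old_injective hv],
        fun v w hvw hx => absurd hx.symm (mid_ne_old hvw u)⟩
    · obtain ⟨h1, h2, h3⟩ := triElim_mid_spec f huv
      obtain ⟨h1', h2', h3'⟩ := triElim_mid_spec f' (huv.map hτ hp)
      have habs : |f'.coeffAt (τ u) (τ v)| = c * |f.coeffAt u v| := by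
        rw [h, abs_mul, abs_mul, abs_mul, hs.abs, hs.abs, abs_of_pos hc]; ring
      obtain ⟨η, hη, e1, e2⟩ := exists_sign
        (p := c * s u * (CutBell.triElim f).coeffAt (old u) (mid u v))
        (q := c * s v * (CutBell.triElim f).coeffAt (old v) (mid u v))
        (p' := (CutBell.triElim f').coeffAt (old (τ u)) (mid (τ u) (τ v)))
        (q' := (CutBell.triElim f').coeffAt (old (τ v)) (mid (τ u) (τ v)))
        (by rw [h1', habs, abs_mul, abs_mul, hs.abs, h1, abs_of_pos hc]; ring)
        (by rw [h2', habs, abs_mul, abs_mul, hs.abs, h2, abs_of_pos hc]; ring)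
        (by
          rw [h3', habs, h]
          linear_combination (-(c ^ 2 * s u * s v)) * h3)
      have e1' : (CutBell.triElim f').coeffAt (old (τ u)) (mid (τ u) (τ v)) =
          c * (s u * η) * (CutBell.triElim f).coeffAt (old u) (mid u v) := by rw [e1]; ring
      have e2' : (CutBell.triElim f').coeffAt (old (τ v)) (mid (τ u) (τ v)) =
          c * (s v * η) * (CutBell.triElim f).coeffAt (old v) (mid u v) := by rw [e2]; ring
      refine ⟨η, hη, fun w hw => absurd hw (mid_ne_old huv w), ?_⟩
      intro u' v' huv' he
      -- The same new node is described by either ordering of its pair.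
      rcases mid_inj huv huv' he with ⟨rfl, rfl⟩ | ⟨rfl, rfl⟩
      · exact ⟨e1', e2'⟩
      · rw [mid_comm (τ v) (τ u), mid_comm v u]
        exact ⟨e2', e1'⟩
  choose t ht hold hmid using hex
  have hom : ∀ z u v, Mates u v →
      (CutBell.triElim f').coeffAt (liftNode τ (old z)) (liftNode τ (mid u v)) =
        c * (t (old z) * t (mid u v)) * (CutBell.triElim f).coeffAt (old z) (mid u v) := by
    intro z u v huv
    rw [liftNode_old, liftNode_mid τ huv, hold _ z rfl]
    by_cases hu : z = u
    · subst hu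
      exact (hmid _ z v huv rfl).1
    by_cases hv : z = v
    · subst hv
      exact (hmid _ u z huv rfl).2
    rw [triElim_old_mid f huv hu hv,
      triElim_old_mid f' (huv.map hτ hp) (hτ.ne hu) (hτ.ne hv), mul_zero]
  refine ⟨t, c, ht, hc, fun x y => ?_⟩
  rcases exists_old_or_mid x with ⟨u, rfl⟩ | ⟨u, v, huv, rfl⟩ <;>
    rcases exists_old_or_mid y with ⟨u', rfl⟩ | ⟨u', v', huv', rfl⟩
  · rw [liftNode_old, liftNode_old, hold _ u rfl, hold _ u' rfl]
    by_cases hpart : u.part = u'.part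
    · rw [triElim_of_part_eq f (by simpa using hpart),
        triElim_of_part_eq f' (by simp [hp u, hp u', hpart]), mul_zero]
    · rw [triElim_old_old f hpart, triElim_old_old f' (by simpa [hp u, hp u'] using hpart), h]
  · exact hom u u' v' huv'
  · rw [Ineq.coeffAt_comm, hom u' u v huv, Ineq.coeffAt_comm _ (old u')]
    ring
  · rw [liftNode_mid τ huv, liftNode_mid τ huv', triElim_mid_mid f huv huv',
      triElim_mid_mid f' (huv.map hτ hp) (huv'.map hτ hp), mul_zero]

theorem EquivComplete.triElim {f f' : Ineq (completeK nA nB)} (hf : f.Tight) (hf' : f'.Tight)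
    (h : EquivComplete f f') : EquivTripartite (triElim f) (triElim f') := by
  obtain ⟨τ, S, c, hτ, hc, rfl⟩ := h
  obtain ⟨π, hπ, hp⟩ := hτ.exists_partsVia
  have hm := (Ineq.matches_of_eq f τ S hc).triElim τ.injective hp
  obtain ⟨S', c', hc', h⟩ :=
    Ineq.Matches.exists_eq (σ := liftIso hπ τ.injective hp) hf.triElim hf'.triElim hm
  exact ⟨liftIso hπ τ.injective hp, S', c',
    (partsVia_liftNode hπ τ.injective hp).map_X hπ, hc', h⟩

/-! ### Automorphisms fixing $X$ and the sizes of the classes -/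

section Tripartite

variable {α β : Type}

/-- Automorphisms of a complete tripartite graph fixing `X` preserve or exchange the other two
classes. -/
theorem exists_partsVia_of_iso (σ : tripartite α β ≃g tripartite α β) (hX : σ X = X) :
    ∃ π : Equiv.Perm (Fin 3), (π = 1 ∨ π = exchange) ∧ PartsVia π σ := by
  -- Lying in one class means being non-adjacent, which automorphisms preserve.
  have hpart : ∀ x y, (σ x).part = (σ y).part ↔ x.part = y.part := by
    intro x y
    have := σ.map_adj_iff (v := x) (w := y)
    simp only [tripartite, SimpleGraph.comap_adj, SimpleGraph.top_adj] at this
    tauto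
  have h0 : ∀ x, (σ x).part = 0 → x.part = 0 := by
    intro x hx
    rw [part_eq_zero] at hx ⊢
    exact σ.injective (hx.trans hX.symm)
  have htri : ∀ p : Fin 3, p = 0 ∨ p = 1 ∨ p = 2 := by decide
  by_cases hsw : ∃ x : Node α β, x.part = 1 ∧ (σ x).part = 2
  · obtain ⟨x, hx1, hx2⟩ := hsw
    refine ⟨exchange, Or.inr rfl, fun y => ?_⟩
    rcases htri y.part with hy | hy | hy
    · rw [hy, part_eq_zero.1 hy, hX]; rfl
    · rw [(hpart y x).2 (hy.trans hx1.symm), hx2, hy]; rfl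
    · rw [hy]
      rcases htri (σ y).part with h | h | h
      · rw [h0 y h] at hy; exact absurd hy (by decide)
      · rw [h]; rfl
      · have := (hpart y x).1 (h.trans hx2.symm)
        rw [hy, hx1] at this
        exact absurd this (by decide)
  · push Not at hsw
    refine ⟨1, Or.inl rfl, fun y => ?_⟩
    have h1 : ∀ x : Node α β, x.part = 1 → (σ x).part = 1 := by
      intro x hx
      rcases htri (σ x).part with h | h | h
      · rw [h0 x h] at hx; exact absurd hx (by decide)
      · exact h
      · exact absurd h (hsw x hx)
    rcases htri y.part with hy | hy | hy
    · rw [hy, part_eq_zero.1 hy, hX]; rfl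
    · rw [h1 y hy, hy]; rfl
    · rw [hy]
      rcases htri (σ y).part with h | h | h
      · rw [h0 y h] at hy; exact absurd hy (by decide)
      -- If `σ y` were in class 1, so would be `σ (σ y)`, and then `y` and `σ y` would share a
      -- class.
      · have := (hpart y (σ y)).1 (by rw [h1 (σ y) h, h])
        rw [hy, h] at this
        exact absurd this (by decide)
      · exact h

theorem PartsVia.card_eq [Fintype α] [Fintype β] {σ : Node α β → Node α β}
    (hσ : Function.Injective σ) (h : PartsVia exchange σ) :
    Fintype.card α = Fintype.card β := by
  have hAB : ∀ i, ∃ j, σ (A i) = B j := fun i => part_eq_two.1 (h (A i))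
  have hBA : ∀ j, ∃ i, σ (B j) = A i := fun j => part_eq_one.1 (h (B j))
  choose g hg using hAB
  choose k hk using hBA
  refine le_antisymm (Fintype.card_le_of_injective g fun i i' hi => ?_)
    (Fintype.card_le_of_injective k fun i i' hi => ?_)
  · exact A.inj (hσ (by rw [hg, hg, hi]))
  · exact B.inj (hσ (by rw [hk, hk, hi]))

end Tripartite

theorem two_mul_card_pair (n : ℕ) : 2 * Fintype.card (Pair n) + n = n * n := by
  have h := sum_pairs (n := n) (g := fun i j => if i = j then 0 else 1)
    (fun i j => by simp [eq_comm]) (by simp)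
  have h1 : ∀ i : Fin n, ∑ j, (if i = j then (0 : ℝ) else 1) = n - 1 := by
    intro i
    have : ∀ j, (if i = j then (0 : ℝ) else 1) = 1 - if i = j then 1 else 0 := by
      intro j; split_ifs <;> simp
    simp [this]
  have h2 : ∀ p : Pair n, (if p.1.1 = p.1.2 then (0 : ℝ) else 1) = 1 :=
    fun p => if_neg p.2.ne
  simp only [h1, h2, Finset.sum_const, Finset.card_univ, Fintype.card_fin, nsmul_eq_mul,
    mul_one] at h
  have : (2 * Fintype.card (Pair n) + n : ℝ) = n * n := by linarith
  exact_mod_cast this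

/-- The difference of the two sizes is $m_A-m_B=\frac12(n_A-n_B)(3-n_A-n_B)$, so the classes may be
exchangeable without $n_A=n_B$; the case $n_A+n_B=3$ must be excluded by other means. -/
theorem eq_or_add_eq_three {nA nB : ℕ}
    (h : Fintype.card (Fin nA ⊕ Pair nB) = Fintype.card (Fin nB ⊕ Pair nA)) :
    nA = nB ∨ nA + nB = 3 := by
  rw [Fintype.card_sum, Fintype.card_sum, Fintype.card_fin, Fintype.card_fin] at h
  have hA := two_mul_card_pair nA
  have hB := two_mul_card_pair nB
  generalize Fintype.card (Pair nA) = a at *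
  generalize Fintype.card (Pair nB) = b at *
  zify at *
  have : ((nA : ℤ) - nB) * (nA + nB - 3) = 0 := by linarith
  rcases mul_eq_zero.1 this with h | h
  · left; linarith
  · right; linarith

/-- Three distinct neighbours in the support. -/
def Big {V : Type*} (a : V → V → ℝ) (u : V) : Prop :=
  ∃ p q r, p ≠ q ∧ p ≠ r ∧ q ≠ r ∧ a u p ≠ 0 ∧ a u q ≠ 0 ∧ a u r ≠ 0

/-! ### Degrees in the support and the dichotomy for facets -/

section Matches

variable {V : Type*} {G : SimpleGraph V} {I J : Ineq G} {σ : V → V}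

theorem Ineq.Matches.ne_zero_iff (h : I.Matches J σ) (u v : V) :
    J.coeffAt (σ u) (σ v) ≠ 0 ↔ I.coeffAt u v ≠ 0 := by
  obtain ⟨s, c, hs, hc, h⟩ := h
  have hne : ∀ u, s u ≠ 0 := fun u h0 => by simpa [h0] using hs.abs u
  rw [h, mul_ne_zero_iff]
  simp [hc.ne', hne]

theorem Ineq.Matches.big_iff (h : I.Matches J σ) (hσ : Function.Bijective σ) (u : V) :
    Big J.coeffAt (σ u) ↔ Big I.coeffAt u := by
  constructor
  · rintro ⟨p, q, r, hpq, hpr, hqr, hp, hq, hr⟩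
    obtain ⟨p, rfl⟩ := hσ.2 p
    obtain ⟨q, rfl⟩ := hσ.2 q
    obtain ⟨r, rfl⟩ := hσ.2 r
    rw [h.ne_zero_iff] at hp hq hr
    exact ⟨p, q, r, ne_of_apply_ne σ hpq, ne_of_apply_ne σ hpr, ne_of_apply_ne σ hqr, hp, hq, hr⟩
  · rintro ⟨p, q, r, hpq, hpr, hqr, hp, hq, hr⟩
    exact ⟨σ p, σ q, σ r, hσ.1.ne hpq, hσ.1.ne hpr, hσ.1.ne hqr, (h.ne_zero_iff _ _).2 hp,
      (h.ne_zero_iff _ _).2 hq, (h.ne_zero_iff _ _).2 hr⟩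

end Matches

section Facets

variable {V : Type*}

theorem Ineq.exists_coeffAt_ne_zero {G : SimpleGraph V} {I : Ineq G} (h : I.coeff ≠ 0) :
    ∃ u v, I.coeffAt u v ≠ 0 := by
  by_contra! h0
  refine h (funext fun ⟨e, he⟩ => ?_)
  induction e using Sym2.ind with
  | _ u v =>
    rw [← I.coeffAt_mk he, h0]; rfl

theorem Ineq.ne_of_coeffAt_ne_zero {G : SimpleGraph V} {I : Ineq G} {u v : V}
    (h : I.coeffAt u v ≠ 0) : u ≠ v := by
  rintro rfl
  simp at h

/-- A support node with one or two neighbours makes the facet a triangle inequality. When there is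
only one neighbour, any third node completes the triangle, whence the bound on the number of nodes.
-/
theorem Ineq.IsFacet.triangle_or_big [Fintype V] (hV : 3 ≤ Fintype.card V)
    {f : Ineq (⊤ : SimpleGraph V)} (hf : f.IsFacet) :
    (∃ u v w, f.TriangleCoeffs u v w) ∨ ∀ u v, f.coeffAt u v ≠ 0 → Big f.coeffAt u := by
  by_contra! hcon
  obtain ⟨hT, u, v, huv, hbig⟩ := hcon
  have hne := Ineq.ne_of_coeffAt_ne_zero huv
  by_cases h2 : ∃ w, w ≠ v ∧ f.coeffAt u w ≠ 0
  · obtain ⟨w, hwv, huw⟩ := h2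
    refine hT u v w (hf.triangleCoeffs hne (Ineq.ne_of_coeffAt_ne_zero huw) hwv.symm ?_
      (Or.inl huv))
    intro t htv htw
    by_contra h0
    exact hbig ⟨v, w, t, hwv.symm, htv.symm, htw.symm, huv, huw, h0⟩
  · push Not at h2
    obtain ⟨w, hw⟩ : ∃ w, w ∉ ({u, v} : Set V) := by
      by_contra! hall
      have : ({u, v} : Set V) = Set.univ := Set.eq_univ_of_forall hall
      have h3 := Set.ncard_pair hne
      rw [this, Set.ncard_univ, Nat.card_eq_fintype_card] at h3
      omega
    simp only [Set.mem_insert_iff, Set.mem_singleton_iff, not_or] at hw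
    exact hT u v w (hf.triangleCoeffs hne (Ne.symm hw.1) (Ne.symm hw.2)
      (fun t htv _ => h2 t htv) (Or.inl huv))

theorem Ineq.TriangleCoeffs.ne_zero_iff {f : Ineq (⊤ : SimpleGraph V)} {u v w : V}
    (h : f.TriangleCoeffs u v w) {x y : V} : f.coeffAt x y ≠ 0 ↔
      x ≠ y ∧ x ∈ ({u, v, w} : Set V) ∧ y ∈ ({u, v, w} : Set V) := by
  obtain ⟨-, -, -, s, k, hs, hk, hin, hout⟩ := h
  constructor
  · intro h0
    exact ⟨Ineq.ne_of_coeffAt_ne_zero h0, hout _ _ h0, hout _ _ (by rwa [Ineq.coeffAt_comm])⟩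
  · rintro ⟨hxy, hx, hy⟩
    have hne : ∀ u, s u ≠ 0 := fun u h0 => by simpa [h0] using hs.abs u
    rw [hin x hx y hy hxy]
    exact mul_ne_zero hk.ne' (mul_ne_zero (hne _) (hne _))

theorem Ineq.TriangleCoeffs.not_big {f : Ineq (⊤ : SimpleGraph V)} {u v w : V}
    (h : f.TriangleCoeffs u v w) (x : V) : ¬ Big f.coeffAt x := by
  rintro ⟨p, q, r, hpq, hpr, hqr, hp, hq, hr⟩
  rw [h.ne_zero_iff] at hp hq hr
  simp only [Set.mem_insert_iff, Set.mem_singleton_iff] at hp hq hr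
  grind

end Facets

/-! ### Extending partial matchings to permutations -/

section Extension

/-- A partial injection of a finite set into itself extends to a permutation; this is applied in
each party separately. -/
theorem exists_perm_extend_id {φ : Node (Fin nA) (Fin nB) → Node (Fin nA) (Fin nB)}
    {s : Set (Node (Fin nA) (Fin nB))} (hφ : Set.InjOn φ s)
    (hp : ∀ u ∈ s, (φ u).part = u.part) :
    ∃ τ : Equiv.Perm (Node (Fin nA) (Fin nB)), (∀ u ∈ s, τ u = φ u) ∧ PartsVia 1 τ := by
  have hA : ∀ i : {i // A i ∈ s}, ∃ k, φ (A i.1) = A k := fun i => part_eq_one.1 (hp _ i.2)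
  have hB : ∀ j : {j // B j ∈ s}, ∃ k, φ (B j.1) = B k := fun j => part_eq_two.1 (hp _ j.2)
  choose a ha using hA
  choose b hb using hB
  obtain ⟨eA, heA⟩ := Equiv.Perm.exists_extending_pair (fun i : {i // A i ∈ s} => i.1) a
    Subtype.val_injective fun i i' h => by
      have := hφ i.2 i'.2 (by rw [ha, ha, h])
      exact Subtype.ext (A.inj this)
  obtain ⟨eB, heB⟩ := Equiv.Perm.exists_extending_pair (fun j : {j // B j ∈ s} => j.1) b
    Subtype.val_injective fun i i' h => by
      have := hφ i.2 i'.2 (by rw [hb, hb, h])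
      exact Subtype.ext (B.inj this)
  refine ⟨⟨fun | X => X | A i => A (eA i) | B j => B (eB j),
    fun | X => X | A i => A (eA.symm i) | B j => B (eB.symm j), ?_, ?_⟩, ?_, ?_⟩
  · rintro (_ | i | j) <;> simp
  · rintro (_ | i | j) <;> simp
  · rintro (_ | i | j) h
    · exact (part_eq_zero.1 (hp _ h)).symm
    · rw [ha ⟨i, h⟩]
      exact congrArg A (heA ⟨i, h⟩)
    · rw [hb ⟨j, h⟩]
      exact congrArg B (heB ⟨j, h⟩)
  · rintro (_ | i | j) <;> rfl

/-- When $n_A=n_B$, composing with $A_i\leftrightarrow B_i$ reduces an exchange to the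
class-preserving case. -/
theorem exists_perm_extend {π : Equiv.Perm (Fin 3)} (hπ : π = 1 ∨ π = exchange ∧ nA = nB)
    {φ : Node (Fin nA) (Fin nB) → Node (Fin nA) (Fin nB)}
    {s : Set (Node (Fin nA) (Fin nB))} (hφ : Set.InjOn φ s)
    (hp : ∀ u ∈ s, (φ u).part = π u.part) :
    ∃ τ : Equiv.Perm (Node (Fin nA) (Fin nB)), (∀ u ∈ s, τ u = φ u) ∧ PartsVia π τ := by
  rcases hπ with rfl | ⟨rfl, rfl⟩
  · exact exists_perm_extend_id hφ hp
  · let ω : Equiv.Perm (Node (Fin nA) (Fin nA)) :=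
      ⟨fun | X => X | A i => B i | B i => A i, fun | X => X | A i => B i | B i => A i,
        by rintro (_ | i | i) <;> rfl, by rintro (_ | i | i) <;> rfl⟩
    have hω : PartsVia exchange ω := by rintro (_ | i | i) <;> rfl
    have hinv : ∀ u, ω (ω u) = u := by rintro (_ | i | i) <;> rfl
    obtain ⟨τ, h1, h2⟩ := exists_perm_extend_id (φ := ω ∘ φ) (s := s)
      (ω.injective.comp_injOn hφ) (fun u hu => by
        rw [Function.comp_apply, hω, hp u hu]
        exact Equiv.swap_apply_self 1 2 _)
    refine ⟨τ.trans ω, fun u hu => ?_, fun u => ?_⟩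
    · rw [Equiv.trans_apply, h1 u hu, Function.comp_apply, hinv]
    · rw [Equiv.trans_apply, hω, h2]; rfl

/-- A partial matching of the supports yields an equivalence of the inequalities. -/
theorem equivComplete_of_partial {f f' : Ineq (completeK nA nB)} (hf : f.Tight) (hf' : f'.Tight)
    {π : Equiv.Perm (Fin 3)} (hπ : π = 1 ∨ π = exchange ∧ nA = nB)
    {φ : Node (Fin nA) (Fin nB) → Node (Fin nA) (Fin nB)}
    {s : Set (Node (Fin nA) (Fin nB))} (hφ : Set.InjOn φ s)
    (hp : ∀ u ∈ s, (φ u).part = π u.part) {t : Node (Fin nA) (Fin nB) → ℝ} (ht : IsSign t) {c : ℝ}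
    (hc : 0 < c)
    (h : ∀ u ∈ s, ∀ v ∈ s, f'.coeffAt (φ u) (φ v) = c * (t u * t v) * f.coeffAt u v)
    (hs : ∀ u v, f.coeffAt u v ≠ 0 → u ∈ s) (hs' : ∀ u v, f'.coeffAt u v ≠ 0 → u ∈ φ '' s) :
    EquivComplete f f' := by
  obtain ⟨τ, hτφ, hτ⟩ := exists_perm_extend hπ hφ hp
  -- Outside `s` both coefficients vanish, so the choice of the extension does not matter.
  have hout : ∀ u v, u ∉ s → f'.coeffAt (τ u) (τ v) = c * (t u * t v) * f.coeffAt u v := by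
    intro u v hu
    have h1 : f.coeffAt u v = 0 := by
      by_contra h0
      exact hu (hs _ _ h0)
    have h2 : f'.coeffAt (τ u) (τ v) = 0 := by
      by_contra h0
      obtain ⟨w, hw, hwu⟩ := hs' _ _ h0
      rw [← hτφ w hw] at hwu
      exact hu (τ.injective hwu ▸ hw)
    rw [h1, h2, mul_zero]
  have hm : f.Matches f' (⟨τ, by simp⟩ : completeK nA nB ≃g completeK nA nB) := by
    refine ⟨t, c, ht, hc, fun u v => ?_⟩
    change f'.coeffAt (τ u) (τ v) = _
    by_cases hu : u ∈ s
    · by_cases hv : v ∈ s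
      · rw [hτφ u hu, hτφ v hv, h u hu v hv]
      · rw [Ineq.coeffAt_comm, hout v u hv, Ineq.coeffAt_comm _ v]; ring
    · exact hout u v hu
  obtain ⟨S, c', hc', he⟩ := hm.exists_eq hf hf'
  have hτ' : PartsVia π (⟨τ, by simp⟩ : completeK nA nB ≃g completeK nA nB) := hτ
  exact ⟨_, S, c', hτ'.respectsParties (hπ.imp id And.left), hc', he⟩

end Extension

/-! ### Support of the elimination; facets of minimum degree three -/

section Support

variable (f : Ineq (completeK nA nB))

open scoped Classical in
/-- The neighbour of `old u` that corresponds to the edge `uv` of `K_n`. -/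
noncomputable def towards (u v : Node (Fin nA) (Fin nB)) :
    Node (Fin nA ⊕ Pair nB) (Fin nB ⊕ Pair nA) :=
  if u.part = v.part then mid u v else old v

theorem towards_of_eq {u v : Node (Fin nA) (Fin nB)} (h : u.part = v.part) :
    towards u v = mid u v := if_pos h

theorem towards_of_ne {u v : Node (Fin nA) (Fin nB)} (h : u.part ≠ v.part) :
    towards u v = old v := if_neg h

theorem towards_inj {u v w : Node (Fin nA) (Fin nB)} (hv : u ≠ v) (hw : u ≠ w)
    (h : towards u v = towards u w) : v = w := by
  by_cases h1 : u.part = v.part <;> by_cases h2 : u.part = w.part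
  · rw [towards_of_eq h1, towards_of_eq h2] at h
    rcases mid_inj ⟨hv, h1⟩ ⟨hw, h2⟩ h with h | h
    · exact h.2
    · exact absurd h.1 hw
  · rw [towards_of_eq h1, towards_of_ne h2] at h
    exact absurd h (mid_ne_old ⟨hv, h1⟩ _)
  · rw [towards_of_ne h1, towards_of_eq h2] at h
    exact absurd h.symm (mid_ne_old ⟨hw, h2⟩ _)
  · rw [towards_of_ne h1, towards_of_ne h2] at h
    exact old_injective h

theorem triElim_mid_ne_zero_iff {u v z : Node (Fin nA) (Fin nB)} (h : Mates u v) :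
    (triElim f).coeffAt (old z) (mid u v) ≠ 0 ↔ (z = u ∨ z = v) ∧ f.coeffAt u v ≠ 0 := by
  obtain ⟨h1, h2, -⟩ := triElim_mid_spec f h
  by_cases hu : z = u
  · subst hu
    rw [← abs_ne_zero, h1, abs_ne_zero]; simp
  by_cases hv : z = v
  · subst hv
    rw [← abs_ne_zero, h2, abs_ne_zero]; simp
  rw [triElim_old_mid f h hu hv]
  simp [hu, hv]

theorem triElim_old_ne_zero_iff {u : Node (Fin nA) (Fin nB)}
    {y : Node (Fin nA ⊕ Pair nB) (Fin nB ⊕ Pair nA)} :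
    (triElim f).coeffAt (old u) y ≠ 0 ↔ ∃ v, f.coeffAt u v ≠ 0 ∧ y = towards u v := by
  constructor
  · intro h
    rcases exists_old_or_mid y with ⟨v, rfl⟩ | ⟨v, w, hvw, rfl⟩
    · have hp : u.part ≠ v.part := by
        intro hp
        exact h (triElim_of_part_eq f (by simpa using hp))
      rw [triElim_old_old f hp] at h
      exact ⟨v, h, (towards_of_ne hp).symm⟩
    · obtain ⟨rfl | rfl, h'⟩ := (triElim_mid_ne_zero_iff f hvw).1 h
      · exact ⟨w, h', (towards_of_eq hvw.2).symm⟩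
      · exact ⟨v, by rwa [Ineq.coeffAt_comm], by rw [towards_of_eq hvw.2.symm, mid_comm]⟩
  · rintro ⟨v, h, rfl⟩
    by_cases hp : u.part = v.part
    · rw [towards_of_eq hp, triElim_mid_ne_zero_iff f ⟨Ineq.ne_of_coeffAt_ne_zero h, hp⟩]
      exact ⟨Or.inl rfl, h⟩
    · rwa [towards_of_ne hp, triElim_old_old f hp]

/-- The map `towards u` is a bijection from the neighbours of `u` in the support of `f` to those of
`old u` in the elimination, so the degrees agree. -/
theorem big_old_iff (u : Node (Fin nA) (Fin nB)) :
    Big (triElim f).coeffAt (old u) ↔ Big f.coeffAt u := by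
  constructor
  · rintro ⟨p, q, r, hpq, hpr, hqr, hp, hq, hr⟩
    rw [triElim_old_ne_zero_iff] at hp hq hr
    obtain ⟨p, hp, rfl⟩ := hp
    obtain ⟨q, hq, rfl⟩ := hq
    obtain ⟨r, hr, rfl⟩ := hr
    exact ⟨p, q, r, ne_of_apply_ne _ hpq, ne_of_apply_ne _ hpr, ne_of_apply_ne _ hqr, hp, hq, hr⟩
  · rintro ⟨p, q, r, hpq, hpr, hqr, hp, hq, hr⟩
    have hp' := Ineq.ne_of_coeffAt_ne_zero hp
    have hq' := Ineq.ne_of_coeffAt_ne_zero hq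
    have hr' := Ineq.ne_of_coeffAt_ne_zero hr
    exact ⟨towards u p, towards u q, towards u r, fun h => hpq (towards_inj hp' hq' h),
      fun h => hpr (towards_inj hp' hr' h), fun h => hqr (towards_inj hq' hr' h),
      (triElim_old_ne_zero_iff f).2 ⟨p, hp, rfl⟩, (triElim_old_ne_zero_iff f).2 ⟨q, hq, rfl⟩,
      (triElim_old_ne_zero_iff f).2 ⟨r, hr, rfl⟩⟩

theorem triElim_mid_left_ne_zero {u v : Node (Fin nA) (Fin nB)} (h : Mates u v)
    {y : Node (Fin nA ⊕ Pair nB) (Fin nB ⊕ Pair nA)}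
    (hy : (triElim f).coeffAt (mid u v) y ≠ 0) :
    (y = old u ∨ y = old v) ∧ f.coeffAt u v ≠ 0 := by
  rcases exists_old_or_mid y with ⟨z, rfl⟩ | ⟨z, w, hzw, rfl⟩
  · rw [Ineq.coeffAt_comm, triElim_mid_ne_zero_iff f h] at hy
    exact ⟨hy.1.imp (congrArg old) (congrArg old), hy.2⟩
  · exact absurd (triElim_mid_mid f h hzw) hy

theorem not_big_mid {u v : Node (Fin nA) (Fin nB)} (h : Mates u v) :
    ¬ Big (triElim f).coeffAt (mid u v) := by
  rintro ⟨p, q, r, hpq, hpr, hqr, hp, hq, hr⟩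
  have hp := (triElim_mid_left_ne_zero f h hp).1
  have hq := (triElim_mid_left_ne_zero f h hq).1
  have hr := (triElim_mid_left_ne_zero f h hr).1
  grind

/-- If all nodes in the support have degree at least three, then `mid u v` is the only common
neighbour of `old u` and `old v` of smaller degree. -/
theorem eq_mid_of_not_big (hbig : ∀ u v, f.coeffAt u v ≠ 0 → Big f.coeffAt u)
    {u v : Node (Fin nA) (Fin nB)} (huv : u ≠ v)
    {x : Node (Fin nA ⊕ Pair nB) (Fin nB ⊕ Pair nA)}
    (hx : ¬ Big (triElim f).coeffAt x) (hu : (triElim f).coeffAt (old u) x ≠ 0)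
    (hv : (triElim f).coeffAt (old v) x ≠ 0) : x = mid u v ∧ f.coeffAt u v ≠ 0 := by
  rcases exists_old_or_mid x with ⟨z, rfl⟩ | ⟨z, w, hzw, rfl⟩
  · rw [Ineq.coeffAt_comm, triElim_old_ne_zero_iff] at hu
    obtain ⟨y, hy, -⟩ := hu
    exact absurd ((big_old_iff f z).2 (hbig _ _ hy)) hx
  · obtain ⟨h1, h0⟩ := (triElim_mid_ne_zero_iff f hzw).1 hu
    obtain ⟨h2, -⟩ := (triElim_mid_ne_zero_iff f hzw).1 hv
    rcases h1 with rfl | rfl <;> rcases h2 with rfl | rfl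
    · exact absurd rfl huv
    · exact ⟨rfl, h0⟩
    · exact ⟨mid_comm _ _, by rwa [Ineq.coeffAt_comm]⟩
    · exact absurd rfl huv

end Support

theorem mul_abs_injective {x y : ℝ} (h : x * |x| = y * |y|) : x = y := by
  rcases abs_cases x with ⟨hx, hx'⟩ | ⟨hx, hx'⟩ <;> rcases abs_cases y with ⟨hy, hy'⟩ | ⟨hy, hy'⟩ <;>
    rw [hx, hy] at h <;> nlinarith

theorem two_le_of_part_one {β : Type} {n : ℕ} {u v : Node (Fin n) β} (h : u ≠ v)
    (hu : u.part = 1) (hv : v.part = 1) : 2 ≤ n := by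
  obtain ⟨i, rfl⟩ := part_eq_one.1 hu
  obtain ⟨j, rfl⟩ := part_eq_one.1 hv
  have : i ≠ j := fun h' => h (congrArg A h')
  omega

theorem two_le_of_part_two {α : Type} {n : ℕ} {u v : Node α (Fin n)} (h : u ≠ v)
    (hu : u.part = 2) (hv : v.part = 2) : 2 ≤ n := by
  obtain ⟨i, rfl⟩ := part_eq_two.1 hu
  obtain ⟨j, rfl⟩ := part_eq_two.1 hv
  have : i ≠ j := fun h' => h (congrArg B h')
  omega

/-- Recovering the equivalence when the supports of both inequalities have minimum degree at least
three. -/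
theorem equivComplete_of_big {f f' : Ineq (completeK nA nB)} (hf : f.IsFacet) (hf' : f'.Tight)
    (hbig : ∀ u v, f.coeffAt u v ≠ 0 → Big f.coeffAt u)
    (hbig' : ∀ u v, f'.coeffAt u v ≠ 0 → Big f'.coeffAt u)
    {σ : elimK nA nB ≃g elimK nA nB} {π : Equiv.Perm (Fin 3)} (hπ : π = 1 ∨ π = exchange)
    (hσ : PartsVia π σ) (hm : (triElim f).Matches (triElim f') σ) : EquivComplete f f' := by
  -- Degree at least three is preserved by `σ`, and new nodes never have it.
  have hφ : ∀ u, ∃ u', Big f.coeffAt u → σ (old u) = old u' := by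
    intro u
    by_cases hu : Big f.coeffAt u
    · rcases exists_old_or_mid (σ (old u)) with ⟨u', h⟩ | ⟨v, w, hvw, h⟩
      · exact ⟨u', fun _ => h⟩
      · have := (hm.big_iff σ.bijective (old u)).2 ((big_old_iff f u).2 hu)
        rw [h] at this
        exact absurd this (not_big_mid f' hvw)
    · exact ⟨u, fun h => absurd h hu⟩
  choose φ hφ using hφ
  have hinj : Set.InjOn φ {u | Big f.coeffAt u} := by
    intro u hu v hv h
    exact old_injective (σ.injective (by rw [hφ u hu, hφ v hv, h]))
  have hp : ∀ u ∈ {u | Big f.coeffAt u}, (φ u).part = π u.part := by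
    intro u hu
    rw [← part_old (φ u), ← hφ u hu, hσ, part_old]
  have hπ' : π = 1 ∨ π = exchange ∧ nA = nB := by
    refine hπ.imp_right ?_
    rintro rfl
    refine ⟨rfl, ?_⟩
    rcases eq_or_add_eq_three (hσ.card_eq σ.injective) with h | h3
    · exact h
    · obtain ⟨u, v, huv⟩ := Ineq.exists_coeffAt_ne_zero hf.coeff_ne_zero
      -- Here $n=4$: a support node with its three neighbours exhausts all nodes, so `φ` is a total
      -- injection exchanging the parties, which forces $n_A=n_B$.
      have hall : ∀ x, Big f.coeffAt x := by
        obtain ⟨p, q, r, hpq, hpr, hqr, hup, huq, hur⟩ := hbig u v huv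
        have h1 := Ineq.ne_of_coeffAt_ne_zero hup
        have h2 := Ineq.ne_of_coeffAt_ne_zero huq
        have h3 := Ineq.ne_of_coeffAt_ne_zero hur
        have huniv : ({u, p, q, r} : Finset (Node (Fin nA) (Fin nB))) = Finset.univ := by
          rw [← Finset.card_eq_iff_eq_univ, card_node, Fintype.card_fin, Fintype.card_fin]
          rw [Finset.card_insert_of_notMem, Finset.card_insert_of_notMem,
            Finset.card_insert_of_notMem, Finset.card_singleton] <;> simp [*]
        intro x
        have hx : x ∈ ({u, p, q, r} : Finset (Node (Fin nA) (Fin nB))) :=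
          huniv ▸ Finset.mem_univ x
        simp only [Finset.mem_insert, Finset.mem_singleton] at hx
        rcases hx with rfl | rfl | rfl | rfl
        · exact hbig _ _ huv
        · exact hbig _ u (by rwa [Ineq.coeffAt_comm])
        · exact hbig _ u (by rwa [Ineq.coeffAt_comm])
        · exact hbig _ u (by rwa [Ineq.coeffAt_comm])
      have h := PartsVia.card_eq (σ := φ) (fun x y h => hinj (hall x) (hall y) h)
        (fun x => hp x (hall x))
      simpa using h
  obtain ⟨s, c, hs, hc, h⟩ := id hm
  have hsq : ∀ x, s x * s x = 1 := fun x => by rcases hs x with h | h <;> rw [h] <;> norm_num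
  refine equivComplete_of_partial hf.tight hf' hπ' hinj hp (t := fun u => s (old u))
    (fun u => hs _) hc ?_ hbig ?_
  · intro u hu v hv
    by_cases huv : u = v
    · subst huv; simp
    have huv' : φ u ≠ φ v := fun h => huv (hinj hu hv h)
    by_cases hpart : u.part = v.part
    · have hM : Mates u v := ⟨huv, hpart⟩
      have hM' : Mates (φ u) (φ v) := ⟨huv', by rw [hp u hu, hp v hv, hpart]⟩
      -- The product of the two coefficients at a new node is $-a|a|$. The unknown sign of the new
      -- node enters it squared and drops out.
      have key : ∀ x, x = mid u v → σ x = mid (φ u) (φ v) →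
          f'.coeffAt (φ u) (φ v) = c * (s (old u) * s (old v)) * f.coeffAt u v := by
        rintro x rfl hx
        refine mul_abs_injective ?_
        have e1 := h (old u) (mid u v)
        have e2 := h (old v) (mid u v)
        rw [hφ u hu, hx] at e1
        rw [hφ v hv, hx] at e2
        have e3 := (triElim_mid_spec f' hM').2.2
        rw [e1, e2] at e3
        have e4 := (triElim_mid_spec f hM).2.2
        rw [abs_mul, abs_mul, abs_mul, hs.abs, hs.abs, abs_of_pos hc]
        linear_combination e3 - c ^ 2 * s (old u) * s (old v) * e4 -
          c ^ 2 * s (old u) * s (old v) * ((triElim f).coeffAt (old u) (mid u v)) *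
          ((triElim f).coeffAt (old v) (mid u v)) * hsq (mid u v)
      by_cases h0 : f.coeffAt u v = 0
      · by_cases h0' : f'.coeffAt (φ u) (φ v) = 0
        · rw [h0, h0', mul_zero]
        · exfalso
          -- The preimage of this new node would be a low-degree common neighbour of `old u` and
          -- `old v`, which needs a nonzero coefficient of `uv`.
          obtain ⟨x, hx⟩ := σ.surjective (mid (φ u) (φ v))
          refine (eq_mid_of_not_big f hbig huv (x := x) ?_ ?_ ?_).2 h0
          · rw [← hm.big_iff σ.bijective, hx]
            exact not_big_mid f' hM'
          · rw [← hm.ne_zero_iff, hφ u hu, hx, triElim_mid_ne_zero_iff f' hM']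
            exact ⟨Or.inl rfl, h0'⟩
          · rw [← hm.ne_zero_iff, hφ v hv, hx, triElim_mid_ne_zero_iff f' hM']
            exact ⟨Or.inr rfl, h0'⟩
      · refine key _ rfl (eq_mid_of_not_big f' hbig' huv' ?_ ?_ ?_).1
        · rw [hm.big_iff σ.bijective]
          exact not_big_mid f hM
        · rw [← hφ u hu, hm.ne_zero_iff, triElim_mid_ne_zero_iff f hM]
          exact ⟨Or.inl rfl, h0⟩
        · rw [← hφ v hv, hm.ne_zero_iff, triElim_mid_ne_zero_iff f hM]
          exact ⟨Or.inr rfl, h0⟩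
    · have hpart' : (φ u).part ≠ (φ v).part := by
        rw [hp u hu, hp v hv]
        exact π.injective.ne hpart
      have e := h (old u) (old v)
      rw [hφ u hu, hφ v hv, triElim_old_old f hpart, triElim_old_old f' hpart'] at e
      exact e
  · intro u' v' huv'
    obtain ⟨x, hx⟩ := σ.surjective (old u')
    have hb : Big (triElim f).coeffAt x := by
      rw [← hm.big_iff σ.bijective, hx, big_old_iff]
      exact hbig' _ _ huv'
    rcases exists_old_or_mid x with ⟨u, rfl⟩ | ⟨v, w, hvw, rfl⟩
    · have hu : Big f.coeffAt u := (big_old_iff f u).1 hb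
      exact ⟨u, hu, old_injective (by rw [← hφ u hu, hx])⟩
    · exact absurd hb (not_big_mid f hvw)

/-- Triangle inequalities whose nodes lie in corresponding classes are equivalent. -/
theorem equivComplete_of_triangles {f f' : Ineq (completeK nA nB)} (hf : f.Tight)
    (hf' : f'.Tight) {u v w u' v' w' : Node (Fin nA) (Fin nB)} (h : f.TriangleCoeffs u v w)
    (h' : f'.TriangleCoeffs u' v' w') {π : Equiv.Perm (Fin 3)}
    (hπ : π = 1 ∨ π = exchange ∧ nA = nB) (hu : u'.part = π u.part) (hv : v'.part = π v.part)
    (hw : w'.part = π w.part) : EquivComplete f f' := by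
  obtain ⟨huv, huw, hvw, s, k, hs, hk, hin, hout⟩ := h
  obtain ⟨huv', huw', hvw', s', k', hs', hk', hin', hout'⟩ := h'
  have hsq : ∀ x, s x * s x = 1 := fun x => by rcases hs x with h | h <;> rw [h] <;> norm_num
  set φ : Node (Fin nA) (Fin nB) → Node (Fin nA) (Fin nB) :=
    fun x => if x = u then u' else if x = v then v' else w'
  have φu : φ u = u' := by simp [φ]
  have φv : φ v = v' := by simp [φ, huv.symm]
  have φw : φ w = w' := by simp [φ, huw.symm, hvw.symm]
  have hinj : Set.InjOn φ {u, v, w} := by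
    rintro x (rfl | rfl | rfl) y (rfl | rfl | rfl) hxy <;> simp_all
  have hmem : ∀ x ∈ ({u, v, w} : Set _), φ x ∈ ({u', v', w'} : Set _) := by
    rintro x (rfl | rfl | rfl) <;> simp [φu, φv, φw]
  -- Both inequalities are sign patterns times a constant: the products of the two patterns and the
  -- ratio of the constants carry one to the other.
  refine equivComplete_of_partial hf hf' hπ hinj ?_ (t := fun x => s x * s' (φ x)) (c := k' / k)
    ?_ (by positivity) ?_ hout ?_
  · rintro x (rfl | rfl | rfl)
    · rw [φu, hu]
    · rw [φv, hv]
    · rw [φw, hw]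
  · intro x
    dsimp only
    rcases hs x with h | h <;> rcases hs' (φ x) with h' | h' <;> simp [h, h']
  · intro x hx y hy
    by_cases hxy : x = y
    · subst hxy; simp
    rw [hin x hx y hy hxy, hin' _ (hmem x hx) _ (hmem y hy) fun h => hxy (hinj hx hy h)]
    field_simp
    linear_combination (-s' (φ x) * s' (φ y)) * (s y * s y * hsq x + hsq y)
  · intro x y hxy
    rcases hout' x y hxy with rfl | rfl | rfl
    · exact ⟨u, by simp, φu⟩
    · exact ⟨v, by simp, φv⟩
    · exact ⟨w, by simp, φw⟩

/-- The nodes in the support of an inequality. -/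
def Ineq.supportNodes {V : Type*} {G : SimpleGraph V} (I : Ineq G) : Set V :=
  {x | ∃ y, I.coeffAt x y ≠ 0}

theorem Ineq.Matches.mem_supportNodes_iff {V : Type*} {G : SimpleGraph V} {I J : Ineq G}
    {σ : V → V} (h : I.Matches J σ) (hσ : Function.Surjective σ) (x : V) :
    σ x ∈ J.supportNodes ↔ x ∈ I.supportNodes := by
  constructor
  · rintro ⟨y, hy⟩
    obtain ⟨y, rfl⟩ := hσ y
    exact ⟨y, (h.ne_zero_iff _ _).1 hy⟩
  · rintro ⟨y, hy⟩
    exact ⟨σ y, (h.ne_zero_iff _ _).2 hy⟩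

theorem Ineq.Matches.ncard_supportNodes {V : Type*} {G : SimpleGraph V} {I J : Ineq G}
    {σ : V → V} (h : I.Matches J σ) (hσ : Function.Bijective σ) :
    J.supportNodes.ncard = I.supportNodes.ncard := by
  have : J.supportNodes = σ '' I.supportNodes := by
    ext x
    obtain ⟨x, rfl⟩ := hσ.2 x
    rw [h.mem_supportNodes_iff hσ.2, hσ.1.mem_set_image]
  rw [this, Set.ncard_image_of_injective _ hσ.1]

/-! ### Triangle inequalities -/

section Triangle

variable {f : Ineq (completeK nA nB)} {u v w : Node (Fin nA) (Fin nB)}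

theorem Ineq.TriangleCoeffs.old_mem_supportNodes (h : f.TriangleCoeffs u v w)
    {z : Node (Fin nA) (Fin nB)} :
    old z ∈ (triElim f).supportNodes ↔ z ∈ ({u, v, w} : Set _) := by
  constructor
  · rintro ⟨y, hy⟩
    obtain ⟨t, ht, -⟩ := (triElim_old_ne_zero_iff f).1 hy
    exact (h.ne_zero_iff.1 ht).2.1
  · intro hz
    obtain ⟨t, ht⟩ : ∃ t, f.coeffAt z t ≠ 0 := by
      have huv := h.1
      have huw := h.2.1
      have hvw := h.2.2.1
      rcases hz with rfl | rfl | rfl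
      · exact ⟨v, h.ne_zero_iff.2 ⟨huv, by simp, by simp⟩⟩
      · exact ⟨w, h.ne_zero_iff.2 ⟨hvw, by simp, by simp⟩⟩
      · exact ⟨u, h.ne_zero_iff.2 ⟨huw.symm, by simp, by simp⟩⟩
    exact ⟨_, (triElim_old_ne_zero_iff f).2 ⟨t, ht, rfl⟩⟩

theorem Ineq.TriangleCoeffs.mid_mem_supportNodes (h : f.TriangleCoeffs u v w)
    {p q : Node (Fin nA) (Fin nB)} (hpq : Mates p q) :
    mid p q ∈ (triElim f).supportNodes ↔ p ∈ ({u, v, w} : Set _) ∧ q ∈ ({u, v, w} : Set _) := by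
  have key : mid p q ∈ (triElim f).supportNodes ↔ f.coeffAt p q ≠ 0 := by
    constructor
    · rintro ⟨y, hy⟩
      exact (triElim_mid_left_ne_zero f hpq hy).2
    · intro h0
      refine ⟨old p, ?_⟩
      rw [Ineq.coeffAt_comm, triElim_mid_ne_zero_iff f hpq]
      exact ⟨Or.inl rfl, h0⟩
  rw [key, h.ne_zero_iff]
  exact and_iff_right hpq.1

/-- The support consists of the three old nodes and one new node for each pair of them in a common
class. Hence the counts 3, 4 and 6 here and in the next two lemmas, which tell the three shapes
apart. -/
theorem Ineq.TriangleCoeffs.ncard_of_parts_ne (h : f.TriangleCoeffs u v w)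
    (huv : u.part ≠ v.part) (huw : u.part ≠ w.part) (hvw : v.part ≠ w.part) :
    (triElim f).supportNodes.ncard = 3 := by
  have : (triElim f).supportNodes = {old u, old v, old w} := by
    ext x
    rcases exists_old_or_mid x with ⟨z, rfl⟩ | ⟨p, q, hpq, rfl⟩
    · rw [h.old_mem_supportNodes]
      simp [old_injective.eq_iff]
    · rw [h.mid_mem_supportNodes hpq]
      obtain ⟨h1, h2⟩ := hpq
      simp only [Set.mem_insert_iff, Set.mem_singleton_iff, mid_ne_old ⟨h1, h2⟩, or_false,
        iff_false]
      grind
  rw [this, Set.ncard_eq_three]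
  exact ⟨_, _, _, old_injective.ne h.1, old_injective.ne h.2.1, old_injective.ne h.2.2.1, rfl⟩

theorem Ineq.TriangleCoeffs.ncard_of_two_parts (h : f.TriangleCoeffs u v w)
    (huv : u.part ≠ v.part) (hvw : v.part = w.part) :
    (triElim f).supportNodes.ncard = 4 := by
  obtain ⟨e1, e2, e3, -⟩ := id h
  have hM : Mates v w := ⟨e3, hvw⟩
  have : (triElim f).supportNodes = {mid v w, old u, old v, old w} := by
    ext x
    rcases exists_old_or_mid x with ⟨z, rfl⟩ | ⟨p, q, hpq, rfl⟩
    · rw [h.old_mem_supportNodes]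
      simp [old_injective.eq_iff, (mid_ne_old hM z).symm]
    · rw [h.mid_mem_supportNodes hpq]
      simp only [Set.mem_insert_iff, Set.mem_singleton_iff, mid_ne_old hpq, or_false]
      constructor
      · rintro ⟨hp, hq⟩
        obtain ⟨h1, h2⟩ := hpq
        have : (p = v ∧ q = w) ∨ (p = w ∧ q = v) := by grind
        rcases this with ⟨rfl, rfl⟩ | ⟨rfl, rfl⟩
        · rfl
        · exact mid_comm _ _
      · intro he
        rcases mid_inj hpq hM he with ⟨rfl, rfl⟩ | ⟨rfl, rfl⟩ <;> simp
  rw [this, Set.ncard_insert_of_notMem (by simp [mid_ne_old hM])]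
  rw [Set.ncard_eq_three.2 ⟨_, _, _, old_injective.ne e1, old_injective.ne e2,
    old_injective.ne e3, rfl⟩]

theorem Ineq.TriangleCoeffs.ncard_of_one_part (h : f.TriangleCoeffs u v w)
    (huv : u.part = v.part) (hvw : v.part = w.part) :
    (triElim f).supportNodes.ncard = 6 := by
  obtain ⟨e1, e2, e3, -⟩ := id h
  have h1 : Mates u v := ⟨e1, huv⟩
  have h2 : Mates u w := ⟨e2, huv.trans hvw⟩
  have h3 : Mates v w := ⟨e3, hvw⟩
  have n12 : mid u v ≠ mid u w := fun he => by
    rcases mid_inj h1 h2 he with h | h <;> grind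
  have n13 : mid u v ≠ mid v w := fun he => by
    rcases mid_inj h1 h3 he with h | h <;> grind
  have n23 : mid u w ≠ mid v w := fun he => by
    rcases mid_inj h2 h3 he with h | h <;> grind
  have : (triElim f).supportNodes = {mid u v, mid u w, mid v w, old u, old v, old w} := by
    ext x
    rcases exists_old_or_mid x with ⟨z, rfl⟩ | ⟨p, q, hpq, rfl⟩
    · rw [h.old_mem_supportNodes]
      simp [old_injective.eq_iff, (mid_ne_old h1 z).symm, (mid_ne_old h2 z).symm,
        (mid_ne_old h3 z).symm]
    · rw [h.mid_mem_supportNodes hpq]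
      simp only [Set.mem_insert_iff, Set.mem_singleton_iff, mid_ne_old hpq, or_false]
      constructor
      · rintro ⟨hp, hq⟩
        have hne := hpq.1
        rcases hp with rfl | rfl | rfl <;> rcases hq with rfl | rfl | rfl <;>
          simp_all [mid_comm]
      · rintro (he | he | he)
        · rcases mid_inj hpq h1 he with ⟨rfl, rfl⟩ | ⟨rfl, rfl⟩ <;> simp
        · rcases mid_inj hpq h2 he with ⟨rfl, rfl⟩ | ⟨rfl, rfl⟩ <;> simp
        · rcases mid_inj hpq h3 he with ⟨rfl, rfl⟩ | ⟨rfl, rfl⟩ <;> simp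
  rw [this, Set.ncard_insert_of_notMem (by simp [mid_ne_old h1, n12, n13]),
    Set.ncard_insert_of_notMem (by simp [mid_ne_old h2, n23]),
    Set.ncard_insert_of_notMem (by simp [mid_ne_old h3]),
    Set.ncard_eq_three.2 ⟨_, _, _, old_injective.ne e1, old_injective.ne e2,
    old_injective.ne e3, rfl⟩]

/-- The three shapes of a triangle relative to the three classes. -/
theorem Ineq.TriangleCoeffs.sorted (h : f.TriangleCoeffs u v w) :
    ∃ u v w, f.TriangleCoeffs u v w ∧
      ((u.part = 0 ∧ v.part = 1 ∧ w.part = 2) ∨ (u.part ≠ v.part ∧ v.part = w.part) ∨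
        (u.part = v.part ∧ v.part = w.part)) := by
  have htri : ∀ p : Fin 3, p = 0 ∨ p = 1 ∨ p = 2 := by decide
  have h1 := h.rotate
  have h2 := h1.rotate
  rcases htri u.part with hu | hu | hu <;> rcases htri v.part with hv | hv | hv <;>
    rcases htri w.part with hw | hw | hw
  all_goals first
    | (refine ⟨u, v, w, h, ?_⟩; rw [hu, hv, hw]; decide)
    | (refine ⟨v, w, u, h1, ?_⟩; rw [hu, hv, hw]; decide)
    | (refine ⟨w, u, v, h2, ?_⟩; rw [hu, hv, hw]; decide)
    | (refine ⟨u, w, v, h.swap, ?_⟩; rw [hu, hv, hw]; decide)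
    | (refine ⟨v, u, w, h1.swap, ?_⟩; rw [hu, hv, hw]; decide)
    | (refine ⟨w, v, u, h2.swap, ?_⟩; rw [hu, hv, hw]; decide)

end Triangle

theorem part_ne_zero_of_mates {u v : Node (Fin nA) (Fin nB)} (h : Mates u v) :
    v.part ≠ 0 := by
  intro h0
  exact h.1 ((part_eq_zero.1 (h.2.trans h0)).trans (part_eq_zero.1 h0).symm)

/-- Recovering the equivalence of two triangle inequalities. -/
theorem equivComplete_of_triangle_matches {f f' : Ineq (completeK nA nB)} (hf : f.Tight)
    (hf' : f'.Tight) (hex : nA = nB ∨ ¬ (OppositeTriangles f f' ∨ OppositeTriangles f' f))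
    {σ : elimK nA nB ≃g elimK nA nB} {π : Equiv.Perm (Fin 3)} (hπ : π = 1 ∨ π = exchange)
    (hσ : PartsVia π σ) (hm : (triElim f).Matches (triElim f') σ)
    (hT : ∃ u v w, f.TriangleCoeffs u v w) (hT' : ∃ u v w, f'.TriangleCoeffs u v w) :
    EquivComplete f f' := by
  obtain ⟨u, v, w, h⟩ := hT
  obtain ⟨u', v', w', h'⟩ := hT'
  obtain ⟨u, v, w, h, hs⟩ := h.sorted
  obtain ⟨u', v', w', h', hs'⟩ := h'.sorted
  have hcard := hm.ncard_supportNodes σ.bijective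
  have htri : ∀ p : Fin 3, p ≠ 0 → p = 1 ∨ p = 2 := by decide
  have hcase : ((u.part = 0 ∧ v.part = 1 ∧ w.part = 2) ∧ u'.part = 0 ∧ v'.part = 1 ∧ w'.part = 2) ∨
      ((u.part ≠ v.part ∧ v.part = w.part) ∧ u'.part ≠ v'.part ∧ v'.part = w'.part) ∨
      ((u.part = v.part ∧ v.part = w.part) ∧ u'.part = v'.part ∧ v'.part = w'.part) := by
    have c0 : ∀ {g : Ineq (completeK nA nB)} {u v w}, g.TriangleCoeffs u v w →
        u.part = 0 ∧ v.part = 1 ∧ w.part = 2 → (triElim g).supportNodes.ncard = 3 :=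
      fun h hp => h.ncard_of_parts_ne (by rw [hp.1, hp.2.1]; decide)
        (by rw [hp.1, hp.2.2]; decide) (by rw [hp.2.1, hp.2.2]; decide)
    have c1 : ∀ {g : Ineq (completeK nA nB)} {u v w}, g.TriangleCoeffs u v w →
        u.part ≠ v.part ∧ v.part = w.part → (triElim g).supportNodes.ncard = 4 :=
      fun h hp => h.ncard_of_two_parts hp.1 hp.2
    have c2 : ∀ {g : Ineq (completeK nA nB)} {u v w}, g.TriangleCoeffs u v w →
        u.part = v.part ∧ v.part = w.part → (triElim g).supportNodes.ncard = 6 :=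
      fun h hp => h.ncard_of_one_part hp.1 hp.2
    rcases hs with hs | hs | hs <;> rcases hs' with hs' | hs' | hs'
    · exact Or.inl ⟨hs, hs'⟩
    · rw [c0 h hs, c1 h' hs'] at hcard; omega
    · rw [c0 h hs, c2 h' hs'] at hcard; omega
    · rw [c1 h hs, c0 h' hs'] at hcard; omega
    · exact Or.inr (Or.inl ⟨hs, hs'⟩)
    · rw [c1 h hs, c2 h' hs'] at hcard; omega
    · rw [c2 h hs, c0 h' hs'] at hcard; omega
    · rw [c2 h hs, c1 h' hs'] at hcard; omega
    · exact Or.inr (Or.inr ⟨hs, hs'⟩)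
  rcases hcase with ⟨⟨a1, a2, a3⟩, b1, b2, b3⟩ | ⟨⟨hne, heq⟩, hne', heq'⟩ | ⟨⟨he1, he2⟩, he1', he2'⟩
  · exact equivComplete_of_triangles hf hf' h h' (Or.inl rfl) (by rw [a1, b1]; rfl)
      (by rw [a2, b2]; rfl) (by rw [a3, b3]; rfl)
  · have hM : Mates v w := ⟨h.2.2.1, heq⟩
    have hM' : Mates v' w' := ⟨h'.2.2.1, heq'⟩
    have hw0 : w.part ≠ 0 := part_ne_zero_of_mates hM
    have hw0' : w'.part ≠ 0 := part_ne_zero_of_mates hM'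
    have hXiff : ∀ {g : Ineq (completeK nA nB)} {u v w}, g.TriangleCoeffs u v w →
        v.part = w.part → w.part ≠ 0 → (X ∈ (triElim g).supportNodes ↔ u.part = 0) := by
      intro g u v w h hvw hw
      change old X ∈ _ ↔ _
      rw [h.old_mem_supportNodes, part_eq_zero]
      constructor
      · rintro (h | h | h)
        · exact h.symm
        · rw [← h] at hvw; exact absurd hvw.symm hw
        · rw [← h] at hw; exact absurd rfl hw
      · rintro rfl; simp
    have hX : u.part = 0 ↔ u'.part = 0 := by
      rw [← hXiff h heq hw0, ← hXiff h' heq' hw0', ← hm.mem_supportNodes_iff σ.surjective,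
        hσ.map_X hπ]
    by_cases hu : u.part = 0
    · have hu' := hX.1 hu
      obtain rfl := part_eq_zero.1 hu
      obtain rfl := part_eq_zero.1 hu'
      have hXv : (triElim f).coeffAt (old X) (old v) ≠ 0 := by
        rw [triElim_old_old f hne]
        exact h.ne_zero_iff.2 ⟨h.1, by simp, by simp⟩
      -- Since `σ` fixes $X$, it sends neighbours of $X$ in the support to neighbours of $X$. These
      -- lie in the party of the triangle, so `π` relates the parties of the two triangles.
      have hXv' : (triElim f').coeffAt (old X) (σ (old v)) ≠ 0 := by
        have := (hm.ne_zero_iff _ _).2 hXv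
        rwa [show σ (old X) = old X from hσ.map_X hπ] at this
      obtain ⟨z, hz, he⟩ := (triElim_old_ne_zero_iff f').1 hXv'
      obtain ⟨hz1, -, hz2⟩ := h'.ne_zero_iff.1 hz
      have hzp : z.part = w'.part := by
        rcases hz2 with rfl | rfl | rfl
        · exact absurd rfl hz1
        · exact heq'
        · rfl
      have hvz : z.part = π v.part := by
        rw [towards_of_ne (by rw [hzp]; exact hw0'.symm)] at he
        rw [← part_old z, ← he, hσ, part_old]
      have hwp : w'.part = π w.part := by rw [← hzp, hvz, heq]
      refine equivComplete_of_triangles hf hf' h h' (hπ.imp_right ?_) ?_ (by rw [heq', hwp, heq])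
        hwp
      · rintro rfl
        refine ⟨rfl, ?_⟩
        rcases eq_or_add_eq_three (hσ.card_eq σ.injective) with h3 | h3
        · exact h3
        · exfalso
          -- One triangle has two nodes of Alice, the other two of Bob, so $n_A+n_B\ge 4$.
          rcases htri _ hw0 with hp | hp
          · have h1 := two_le_of_part_one hM.1 (heq.trans hp) hp
            have hp' : w'.part = 2 := by rw [hwp, hp]; rfl
            have h2 := two_le_of_part_two hM'.1 (heq'.trans hp') hp'
            omega
          · have h1 := two_le_of_part_two hM.1 (heq.trans hp) hp
            have hp' : w'.part = 1 := by rw [hwp, hp]; rfl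
            have h2 := two_le_of_part_one hM'.1 (heq'.trans hp') hp'
            omega
      · rcases hπ with rfl | rfl <;> rfl
    · have hu' := mt hX.2 hu
      have hopp : ∀ {g g' : Ineq (completeK nA nB)} {u v w u' v' w'}, g.Tight → g'.Tight →
          g.TriangleCoeffs u v w → g'.TriangleCoeffs u' v' w' → u.part = 2 → v.part = 1 →
          w.part = 1 → u'.part = 1 → v'.part = 2 → w'.part = 2 → OppositeTriangles g g' := by
        intro g g' u v w u' v' w' hg hg' h h' hu hv hw hu' hv' hw'
        obtain ⟨_, rfl⟩ := part_eq_two.1 hu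
        obtain ⟨_, rfl⟩ := part_eq_one.1 hv
        obtain ⟨_, rfl⟩ := part_eq_one.1 hw
        obtain ⟨_, rfl⟩ := part_eq_one.1 hu'
        obtain ⟨_, rfl⟩ := part_eq_two.1 hv'
        obtain ⟨_, rfl⟩ := part_eq_two.1 hw'
        exact Or.inl ⟨_, _, _, _, _, _, h.rotate.isTriangleOn hg, h'.rotate.isTriangleOn hg'⟩
      rw [heq] at hne
      rw [heq'] at hne'
      -- Without $X$ the elimination is a 4-cycle with two nodes in each class, from which the
      -- majority party cannot be read off. Equal shapes match directly; opposite ones are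
      -- equivalent by an exchange if $n_A=n_B$ and excluded otherwise.
      rcases htri _ hu with a1 | a1 <;> rcases htri _ hw0 with a2 | a2 <;>
        rcases htri _ hu' with b1 | b1 <;> rcases htri _ hw0' with b2 | b2
      all_goals first
        | exact absurd (a1.trans a2.symm) hne
        | exact absurd (b1.trans b2.symm) hne'
        | exact equivComplete_of_triangles hf hf' h h' (Or.inl rfl) (by rw [a1, b1]; rfl)
            (by rw [heq, heq', a2, b2]; rfl) (by rw [a2, b2]; rfl)
        | refine equivComplete_of_triangles hf hf' h h' (π := exchange) (Or.inr ⟨rfl, ?_⟩)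
            (by rw [a1, b1]; rfl) (by rw [heq, heq', a2, b2]; rfl) (by rw [a2, b2]; rfl)
          refine hex.resolve_right (not_not_intro ?_)
          first
            | exact Or.inl (hopp hf hf' h h' a1 (heq.trans a2) a2 b1 (heq'.trans b2) b2)
            | exact Or.inr (hopp hf' hf h' h b1 (heq'.trans b2) b2 a1 (heq.trans a2) a2)
  · have hw0 : w.part ≠ 0 := part_ne_zero_of_mates ⟨h.2.2.1, he2⟩
    have hw0' : w'.part ≠ 0 := part_ne_zero_of_mates ⟨h'.2.2.1, he2'⟩
    have hopp : ∀ {g g' : Ineq (completeK nA nB)} {u v w u' v' w'}, g.Tight → g'.Tight →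
        g.TriangleCoeffs u v w → g'.TriangleCoeffs u' v' w' → u.part = 1 → v.part = 1 →
        w.part = 1 → u'.part = 2 → v'.part = 2 → w'.part = 2 → OppositeTriangles g g' := by
      intro g g' u v w u' v' w' hg hg' h h' hu hv hw hu' hv' hw'
      obtain ⟨_, rfl⟩ := part_eq_one.1 hu
      obtain ⟨_, rfl⟩ := part_eq_one.1 hv
      obtain ⟨_, rfl⟩ := part_eq_one.1 hw
      obtain ⟨_, rfl⟩ := part_eq_two.1 hu'
      obtain ⟨_, rfl⟩ := part_eq_two.1 hv'
      obtain ⟨_, rfl⟩ := part_eq_two.1 hw'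
      exact Or.inr ⟨_, _, _, _, _, _, h.isTriangleOn hg, h'.isTriangleOn hg'⟩
    have fin : ∀ π : Equiv.Perm (Fin 3), π = 1 ∨ π = exchange ∧ nA = nB →
        w'.part = π w.part → EquivComplete f f' := fun π hπ hw =>
      equivComplete_of_triangles hf hf' h h' hπ (by rw [he1', he2', he1, he2, hw])
        (by rw [he2', he2, hw]) hw
    -- The elimination is a hexagon for both $AAA$ and $BBB$; opposite parties again rely on `hex`.
    rcases htri _ hw0 with a | a <;> rcases htri _ hw0' with b | b
    · exact fin 1 (Or.inl rfl) (by rw [a, b]; rfl)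
    · refine fin exchange (Or.inr ⟨rfl, hex.resolve_right (not_not_intro (Or.inl ?_))⟩)
        (by rw [a, b]; rfl)
      exact hopp hf hf' h h' (he1.trans (he2.trans a)) (he2.trans a) a
        (he1'.trans (he2'.trans b)) (he2'.trans b) b
    · refine fin exchange (Or.inr ⟨rfl, hex.resolve_right (not_not_intro (Or.inr ?_))⟩)
        (by rw [a, b]; rfl)
      exact hopp hf' hf h' h (he1'.trans (he2'.trans b)) (he2'.trans b) b
        (he1.trans (he2.trans a)) (he2.trans a) a
    · exact fin 1 (Or.inl rfl) (by rw [a, b]; rfl)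

/-- With at most two nodes there is only one edge, and all facets are equivalent. -/
theorem equivComplete_of_card_le_two (hn : nA + nB ≤ 1) {f f' : Ineq (completeK nA nB)}
    (hf : f.IsFacet) (hf' : f'.IsFacet) : EquivComplete f f' := by
  obtain ⟨u, v, h⟩ := Ineq.exists_coeffAt_ne_zero hf.coeff_ne_zero
  obtain ⟨u', v', h'⟩ := Ineq.exists_coeffAt_ne_zero hf'.coeff_ne_zero
  have huv := Ineq.ne_of_coeffAt_ne_zero h
  have huv' := Ineq.ne_of_coeffAt_ne_zero h'
  have hall : ∀ x, x = u ∨ x = v := by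
    have huniv : ({u, v} : Finset (Node (Fin nA) (Fin nB))) = Finset.univ := by
      rw [← Finset.card_eq_iff_eq_univ]
      refine le_antisymm (Finset.card_le_univ _) ?_
      rw [card_node, Fintype.card_fin, Fintype.card_fin, Finset.card_pair huv]
      omega
    intro x
    have hx : x ∈ ({u, v} : Finset (Node (Fin nA) (Fin nB))) := huniv ▸ Finset.mem_univ x
    simpa using hx
  have h0' : f'.coeffAt u v ≠ 0 := by
    rcases hall u' with rfl | rfl <;> rcases hall v' with rfl | rfl
    · exact absurd rfl huv'
    · exact h'
    · rwa [Ineq.coeffAt_comm]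
    · exact absurd rfl huv'
  -- On a single edge the ratio of the coefficients is a positive factor times a sign, and switching
  -- at `u` absorbs the sign.
  obtain ⟨t, c, ht, hc, hr⟩ : ∃ t c : ℝ, (t = 1 ∨ t = -1) ∧ 0 < c ∧
      f'.coeffAt u v = c * t * f.coeffAt u v := by
    rcases lt_or_gt_of_ne (div_ne_zero h0' h) with hneg | hpos
    · exact ⟨-1, -(f'.coeffAt u v / f.coeffAt u v), Or.inr rfl, by linarith, by field_simp⟩
    · exact ⟨1, f'.coeffAt u v / f.coeffAt u v, Or.inl rfl, hpos, by field_simp⟩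
  refine equivComplete_of_partial hf.tight hf'.tight (π := 1) (Or.inl rfl) (φ := id)
    (s := Set.univ) (Set.injOn_id _) (fun _ _ => rfl) (t := fun x => if x = u then t else 1)
    ?_ hc ?_ (fun _ _ _ => trivial) (fun u _ _ => ⟨u, trivial, rfl⟩)
  · intro x
    dsimp only
    split_ifs
    · exact ht
    · exact Or.inl rfl
  · intro x _ y _
    simp only [id]
    rcases hall x with rfl | rfl <;> rcases hall y with rfl | rfl
    · simp
    · simp [huv.symm, hr]
    · rw [Ineq.coeffAt_comm, hr, Ineq.coeffAt_comm f]
      simp [huv.symm]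
    · simp

end CutBell

/-! ### The theorem -/

open CutBell in
theorem theorem2p3 (nA nB : ℕ) (f f' : Ineq (completeK nA nB))
    (hf : f.IsFacet) (hf' : f'.IsFacet)
    (hex : nA = nB ∨ ¬ (OppositeTriangles f f' ∨ OppositeTriangles f' f)) :
    EquivComplete f f' ↔ EquivTripartite (triElim f) (triElim f') := by
  refine ⟨EquivComplete.triElim hf.tight hf'.tight, ?_⟩
  rintro ⟨σ, S, c, hX, hc, hF⟩
  have hm : (triElim f).Matches (triElim f') σ := hF ▸ Ineq.matches_of_eq _ σ S hc
  obtain ⟨π, hπ, hσ⟩ := exists_partsVia_of_iso σ hX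
  by_cases hn : nA + nB ≤ 1
  · exact equivComplete_of_card_le_two hn hf hf'
  have hV : 3 ≤ Fintype.card (Node (Fin nA) (Fin nB)) := by
    rw [Node.card_node, Fintype.card_fin, Fintype.card_fin]; omega
  have hbig : ∀ {g : Ineq (completeK nA nB)}, g.IsFacet →
      (∀ u v, g.coeffAt u v ≠ 0 → Big g.coeffAt u) → ∃ u, Big g.coeffAt u := by
    intro g hg h
    obtain ⟨u, v, huv⟩ := Ineq.exists_coeffAt_ne_zero hg.coeff_ne_zero
    exact ⟨u, h u v huv⟩
  have hnot : ∀ {g : Ineq (completeK nA nB)}, (∃ u v w, g.TriangleCoeffs u v w) →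
      ∀ x, ¬ Big (triElim g).coeffAt x := by
    rintro g ⟨u, v, w, hg⟩ x hx
    rcases exists_old_or_mid x with ⟨z, rfl⟩ | ⟨p, q, hpq, rfl⟩
    · exact hg.not_big z ((big_old_iff g z).1 hx)
    · exact not_big_mid g hpq hx
  -- The mixed cases cannot occur: the elimination of a triangle inequality has no node of degree
  -- three or more, the other kind has one, and `σ` preserves this.
  rcases hf.triangle_or_big hV with hT | hB <;> rcases hf'.triangle_or_big hV with hT' | hB'
  · exact equivComplete_of_triangle_matches hf.tight hf'.tight hex hπ hσ hm hT hT'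
  · obtain ⟨u, hu⟩ := hbig hf' hB'
    obtain ⟨x, hx⟩ := σ.surjective (old u)
    refine absurd ?_ (hnot hT x)
    rw [← hm.big_iff σ.bijective, hx, big_old_iff]
    exact hu
  · obtain ⟨u, hu⟩ := hbig hf hB
    exact absurd ((hm.big_iff σ.bijective _).2 ((big_old_iff f u).2 hu)) (hnot hT' _)
  · exact equivComplete_of_big hf hf'.tight hB hB' hπ hσ hm
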